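/- Consider the separable problem $$\text{(cP)}\qquad \min\ \sum_{i=1}^n f_i(x_i)\quad\text{s.t.}\quad \sum_{i=1}^n g_i(x_i)\le b,\quad x_i\in Y_i\ (i=1,\dots,n),$$ where $f_i:\mathbb{R}^{d_i}\to\mathbb{R}\cup\{+\infty\}$ is lower semicontinuous, $g_i:\mathbb{R}^{d_i}\to\mathbb{R}^m$ has lower semicontinuous coordinates $g_i^k$, $Y_i\subset\operatorname{dom} f_i$ is compact, and $b\in\mathbb{R}^m$. Inequalities between vectors are coordinatewise and $\mathbf 1_{Y}$ is $0$ on $Y$ and $+\infty$ outside $Y$. *Notation.* $\varphi^*(y)=\sup_x\{\langle y,x\rangle-\varphi(x)\}$ and $\varphi^{**}=(\varphi^*)^*$. For $\varphi$ on $\mathbb{R}^d$ let $\rho(\varphi)=\sup_{x\in\operatorname{dom}\varphi}\{\varphi(x)-\varphi^{**}(x)\}$, and for $k\ge 1$ let $\rho_k(\varphi)$ be the supremum of $\varphi\big(\sum_{j=1}^{d+1}\alpha_jx_j\big)-\sum_{j=1}^{d+1}\alpha_j\varphi(x_j)$ over $x_j\in\operatorname{dom}\varphi$, $\alpha\ge0$,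 $\sum_j\alpha_j=1$, with at most $k$ of the $\alpha_j$ nonzero. Put $\tilde f_i=f_i+\mathbf 1_{Y_i}$ and $\bar\rho_g=\sup_{i,k}\rho(g_i^k+\mathbf 1_{Y_i})$ (equal to $0$ if $n=0$ or $m=0$). For $u\in\mathbb{R}^m$ let $$h_{cP}(u)=\inf\Big\{\sum_i f_i(x_i):\ x_i\in Y_i,\ \sum_i g_i(x_i)-b\le u\Big\},\qquad h_{cD}=h_{cP}^{**}.$$ Let $\Psi(\lambda)=\inf_{x_i\in Y_i}\{\sum_i f_i(x_i)+\lambda^\top(\sum_i g_i(x_i)-b)\}$ be the Lagrange dual function; the dual problem (cD) is $\sup_{\lambda\ge0}\Psi(\lambda)$. Let $\mathcal G^{**}\subset\mathbb{R}^{1+m}$ be the closed convex hull of $$\mathcal G=\Big\{(r_0,r):\ \exists x_i\in Y_i,\ \sum_if_i(x_i)\le r_0,\ \sum_ig_i(x_i)-b\le r\Big\}.$$ We say that $z=(r_0,r)$ *attains the minimum in* (cD) if $z\in\mathcal G^{**}$, $r\le0$, $r_0=\sup_{\lambda\ge0}\Psi(\lambda)$ and, for every dual optimal $\lambda\ge0$,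 $z$ minimizes $r_0+\lambda^\top r$ over $\mathcal G^{**}$, with minimum value $\Psi(\lambda)$. Let $\mathcal F_i=\{(f_i(x),g_i(x)):x\in Y_i\}\subset\mathbb{R}^{1+m}$ and $$M_V=\sup\Big\{\Big\|\sum_iu_iv_i\Big\|_2:\ \|u\|_2\le1,\ v_i\in\mathcal F_i\Big\}\in[0,\infty].$$ A *representation* consists of points $x_{ij}\in Y_i$ and weights $\lambda_{ij}\ge0$ ($1\le i\le n$, $1\le j\le m+2$) with $\sum_j\lambda_{ij}=1$ for every $i$; write $z_{ij}=(f_i(x_{ij}),g_i(x_{ij}))$. Put $R_v=\max_{\{ij:\lambda_{ij}\ne1\}}\|\lambda_{ij}z_{ij}\|_2$ and $R_\lambda=\max_{\{ij:\lambda_{ij}\neq1\}}|\lambda_{ij}|$ (both $0$ if there are no such $ij$). **Statement.** There is an absolute constant $c>0$ such that the following holds for all such data with: every $\tilde f_i+\mathbf 1^\top g_i$ is proper, 1-coercive (it eventually exceeds $C\|x\|$, for every $C$, as $\|x\|\to\infty$), lower semicontinuous and minorized by an affine function; $\bar\rho_g<\infty$; and $h_{cD}(0)<+\infty$ (which holds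 if (cP) is feasible). 1. $h_{cD}(0)=\sup_{\lambda\ge0}\Psi(\lambda)$. 2. There exist a representation $(x^\star_{ij},\lambda_{ij})$ with at most $n+m+1$ nonzero weights in total and $w\in\mathbb{R}^m_+$ such that $$z^\star=\sum_{i=1}^n\sum_{j=1}^{m+2}\lambda_{ij}\,(f_i(x^\star_{ij}),g_i(x^\star_{ij}))+(0,-b+w)$$ attains the minimum in (cD). 3. For every such representation and $w$, and every $\gamma>0$, put $s=n+1+2m\frac{c}{\gamma^2+c}$. There is a representation $(y_{ij},\mu_{ij})$ with at most $s$ nonzero weights in total such that the error $$u(s)=(u_1(s),u_2(s))=\sum_{i,j}\mu_{ij}\,(f_i(y_{ij}),g_i(y_{ij}))+(0,-b+w)-z^\star\in\mathbb{R}\times\mathbb{R}^m$$ satisfies $$h_{cD}\big(u_2(s)+(m+1)\bar\rho_g\mathbf 1\big)\le h_{cP}\big(u_2(s)+(m+1)\bar\rho_g\mathbf 1\big)\le h_{cD}(0)+\mathrm{gap}(s),$$ $$\mathrm{gap}(s)=|u_1(s)|+\max_{\beta_i\in\{1,\dots,m+2\}}\Big\{\sum_{i=1}^n\rho_{\beta_i}(\tilde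 f_i):\ \sum_{i=1}^n\beta_i\le s\Big\},$$ and $$\max\{|u_1(s)|,\|u_2(s)\|_2\}\le\sqrt{2m}\,(R_v+R_\lambda M_V)\,\gamma .$$ (In the last bound $0\cdot\infty=0$; $\mathrm{gap}(s)$ may be $+\infty$.) -/

import Mathlib

/-- `ℝᵏ` with its Euclidean norm. -/
abbrev Vec (k : ℕ) : Type := EuclideanSpace ℝ (Fin k)

/-- `ℝ^(1+m)` with its Euclidean norm, written as pairs `(r₀, r)`, `r₀ ∈ ℝ`, `r ∈ ℝᵐ`. -/
abbrev ValSpace (m : ℕ) : Type := WithLp 2 (ℝ × Vec m)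

/-- The effective domain of an extended-real-valued function. -/
def effDom {d : ℕ} (φ : Vec d → EReal) : Set (Vec d) := {x | φ x < ⊤}

/-- The Fenchel conjugate `φ*(y) = sup_x (⟨y, x⟩ - φ(x))`. -/
noncomputable def fenchelConj {d : ℕ} (φ : Vec d → EReal) (y : Vec d) : EReal :=
  ⨆ x : Vec d, ((inner ℝ y x : ℝ) : EReal) - φ x

/-- The biconjugate `φ**` (the supremum of all affine minorants of `φ`). -/
noncomputable def biconj {d : ℕ} (φ : Vec d → EReal) : Vec d → EReal :=
  fenchelConj (fenchelConj φ)

open Classical in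
/-- The function `φ + 𝟏_Y`, equal to `φ` on `Y` and to `+∞` outside of `Y`. -/
noncomputable def extendTop {d : ℕ} (φ : Vec d → EReal) (Y : Set (Vec d)) (x : Vec d) : EReal :=
  if x ∈ Y then φ x else ⊤

/-- The lack of convexity `ρ(φ) = sup_{x ∈ dom φ} (φ(x) - φ**(x))`. -/
noncomputable def rho {d : ℕ} (φ : Vec d → EReal) : EReal :=
  ⨆ x ∈ effDom φ, φ x - biconj φ x

/-- The `k`-th nonconvexity measure: the supremum of `φ(∑ αⱼ xⱼ) - ∑ αⱼ φ(xⱼ)` over `d + 1` points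
of `dom φ` and convex weights with at most `k` nonzero entries. -/
noncomputable def rhoK {d : ℕ} (k : ℕ) (φ : Vec d → EReal) : EReal :=
  ⨆ (x : Fin (d + 1) → Vec d) (α : Fin (d + 1) → ℝ)
    (_ : (∀ j, x j ∈ effDom φ) ∧ (∀ j, 0 ≤ α j) ∧ ∑ j, α j = 1 ∧ {j | α j ≠ 0}.ncard ≤ k),
    φ (∑ j, α j • x j) - ((∑ j, α j * (φ (x j)).toReal : ℝ) : EReal)

/-- Proper, 1-coercive, lower semicontinuous, and minorized by an affine function. -/
structure IsTame {d : ℕ} (φ : Vec d → EReal) : Prop where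
  dom_nonempty : (effDom φ).Nonempty
  ne_bot : ∀ x, φ x ≠ ⊥
  coercive : ∀ C : ℝ, ∀ᶠ x in Bornology.cobounded (Vec d), ((C * ‖x‖ : ℝ) : EReal) ≤ φ x
  lsc : LowerSemicontinuous φ
  affine_minorant : ∃ (a : Vec d) (c : ℝ), ∀ x, ((inner ℝ a x + c : ℝ) : EReal) ≤ φ x

/-- Data of the problem: minimize `∑ᵢ fᵢ(xᵢ)` subject to `∑ᵢ gᵢ(xᵢ) ≤ b` and `xᵢ ∈ Yᵢ`. -/
structure SepProblem (n m : ℕ) (d : Fin n → ℕ) where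
  f : ∀ i, Vec (d i) → EReal
  g : ∀ i, Vec (d i) → Vec m
  Y : ∀ i, Set (Vec (d i))
  b : Vec m

namespace SepProblem

/-- The objective term `fᵢ + 𝟏_{Yᵢ}`. -/
noncomputable def fY {n m : ℕ} {d : Fin n → ℕ} (P : SepProblem n m d) (i : Fin n) :
    Vec (d i) → EReal :=
  extendTop (P.f i) (P.Y i)

/-- The `k`-th coordinate of `gᵢ`, extended by `+∞` outside of `Yᵢ`. -/
noncomputable def gY {n m : ℕ} {d : Fin n → ℕ} (P : SepProblem n m d) (i : Fin n) (k : Fin m) :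
    Vec (d i) → EReal :=
  extendTop (fun x => ((P.g i x k : ℝ) : EReal)) (P.Y i)

/-- The value function `h_cP(u)` of the primal problem with constraints `∑ᵢ gᵢ(xᵢ) - b ≤ u`. -/
noncomputable def hcP {n m : ℕ} {d : Fin n → ℕ} (P : SepProblem n m d) (u : Vec m) : EReal :=
  ⨅ (x : ∀ i, Vec (d i))
    (_ : (∀ i, x i ∈ P.Y i) ∧ ∀ k, ∑ i, P.g i (x i) k - P.b k ≤ u k), ∑ i, P.f i (x i)

/-- `h_cD = h_cP**`. -/
noncomputable def hcD {n m : ℕ} {d : Fin n → ℕ} (P : SepProblem n m d) : Vec m → EReal :=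
  biconj P.hcP

/-- The Lagrange dual function. -/
noncomputable def Psi {n m : ℕ} {d : Fin n → ℕ} (P : SepProblem n m d) (lam : Vec m) : EReal :=
  ⨅ (x : ∀ i, Vec (d i)) (_ : ∀ i, x i ∈ P.Y i),
    ∑ i, P.f i (x i) + ((∑ k, lam k * (∑ i, P.g i (x i) k - P.b k) : ℝ) : EReal)

/-- The optimal value of the Lagrange dual problem `sup_{lam ≥ 0} Ψ(lam)`. -/
noncomputable def dualValue {n m : ℕ} {d : Fin n → ℕ} (P : SepProblem n m d) : EReal :=
  ⨆ (lam : Vec m) (_ : ∀ k, 0 ≤ lam k), P.Psi lam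

/-- The epigraph of the problem, projected on the objective and constraint values. -/
def epiSet {n m : ℕ} {d : Fin n → ℕ} (P : SepProblem n m d) : Set (ValSpace m) :=
  {z | ∃ x : ∀ i, Vec (d i), (∀ i, x i ∈ P.Y i) ∧
    ∑ i, P.f i (x i) ≤ ((z.fst : ℝ) : EReal) ∧ ∀ k, ∑ i, P.g i (x i) k - P.b k ≤ z.snd k}

/-- The closed convex hull of the projected epigraph. -/
def epiHull {n m : ℕ} {d : Fin n → ℕ} (P : SepProblem n m d) : Set (ValSpace m) :=
  closure (convexHull ℝ P.epiSet)

/-- `z = (r₀, r)` attains the minimum in the dual problem: it lies in the closed convex hull of the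
epigraph, `r ≤ 0`, `r₀` is the dual value, and for every dual optimal multiplier `lam` it
minimizes `r₀ + ⟨lam, r⟩` over that hull, with minimum value `Ψ(lam)`. -/
structure AttainsDual {n m : ℕ} {d : Fin n → ℕ} (P : SepProblem n m d) (z : ValSpace m) :
    Prop where
  mem_hull : z ∈ P.epiHull
  nonpos : ∀ k, z.snd k ≤ 0
  value : ((z.fst : ℝ) : EReal) = P.dualValue
  lagrangian : ∀ lam : Vec m, (∀ k, 0 ≤ lam k) → P.Psi lam = P.dualValue →
    IsMinOn (fun y : ValSpace m => y.fst + ∑ k, lam k * y.snd k) P.epiHull z ∧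
      ((z.fst + ∑ k, lam k * z.snd k : ℝ) : EReal) = P.Psi lam

/-- The point `(fᵢ(x), gᵢ(x))` of `ℝ^(1+m)`. -/
noncomputable def val {n m : ℕ} {d : Fin n → ℕ} (P : SepProblem n m d) (i : Fin n)
    (x : Vec (d i)) : ValSpace m :=
  WithLp.toLp 2 ((P.f i x).toReal, P.g i x)

/-- The points `x i j` lie in `Yᵢ` and each row of `lam` is a vector of convex weights. -/
def IsRep {n m : ℕ} {d : Fin n → ℕ} (P : SepProblem n m d)
    (x : ∀ i, Fin (m + 2) → Vec (d i)) (lam : Fin n → Fin (m + 2) → ℝ) : Prop :=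
  (∀ i j, x i j ∈ P.Y i) ∧ (∀ i j, 0 ≤ lam i j) ∧ ∀ i, ∑ j, lam i j = 1

/-- The point `∑ᵢ ∑ⱼ lamᵢⱼ (fᵢ(xᵢⱼ), gᵢ(xᵢⱼ)) + (0, -b + w)`. -/
noncomputable def repPoint {n m : ℕ} {d : Fin n → ℕ} (P : SepProblem n m d)
    (x : ∀ i, Fin (m + 2) → Vec (d i)) (lam : Fin n → Fin (m + 2) → ℝ) (w : Vec m) : ValSpace m :=
  ∑ i, ∑ j, lam i j • P.val i (x i j) + WithLp.toLp 2 (0, -P.b + w)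

/-- `R_v`, the maximum of `‖lamᵢⱼ (fᵢ(xᵢⱼ), gᵢ(xᵢⱼ))‖₂` over the `i, j` with `lamᵢⱼ ≠ 1`. -/
noncomputable def Rv {n m : ℕ} {d : Fin n → ℕ} (P : SepProblem n m d)
    (x : ∀ i, Fin (m + 2) → Vec (d i)) (lam : Fin n → Fin (m + 2) → ℝ) : ENNReal :=
  ⨆ (i : Fin n) (j : Fin (m + 2)) (_ : lam i j ≠ 1), ‖lam i j • P.val i (x i j)‖ₑ

/-- `M_V`, the supremum of `‖∑ᵢ uᵢ vᵢ‖₂` over `‖u‖₂ ≤ 1` and `vᵢ ∈ {(fᵢ(x), gᵢ(x)) : x ∈ Yᵢ}`. -/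
noncomputable def MV {n m : ℕ} {d : Fin n → ℕ} (P : SepProblem n m d) : ENNReal :=
  ⨆ (u : Vec n) (x : ∀ i, Vec (d i)) (_ : ‖u‖ ≤ 1 ∧ ∀ i, x i ∈ P.Y i),
    ‖∑ i, u i • P.val i (x i)‖ₑ

/-- `ρ̄_g`, the supremum of the lacks of convexity of the coordinates of the `gᵢ`. -/
noncomputable def rhoBarG {n m : ℕ} {d : Fin n → ℕ} (P : SepProblem n m d) : EReal :=
  ⨆ (i : Fin n) (k : Fin m), rho (P.gY i k)

/-- The maximum of `∑ᵢ ρ_{βᵢ}(fᵢ)` over integers `βᵢ ∈ [1, m + 2]` with `∑ᵢ βᵢ ≤ s`. -/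
noncomputable def maxRho {n m : ℕ} {d : Fin n → ℕ} (P : SepProblem n m d) (s : ℝ) : EReal :=
  ⨆ (β : Fin n → ℕ) (_ : (∀ i, 1 ≤ β i ∧ β i ≤ m + 2) ∧ ((∑ i, β i : ℕ) : ℝ) ≤ s),
    ∑ i, rhoK (β i) (P.fY i)

/-- The perturbation `u + (m + 1) ρ̄_g 𝟏`. -/
noncomputable def shift {n m : ℕ} {d : Fin n → ℕ} (P : SepProblem n m d) (u : Vec m) : Vec m :=
  WithLp.toLp 2 fun k => u k + (m + 1) * P.rhoBarG.toReal

end SepProblem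

/-- `R_lam`, the maximum of `|lamᵢⱼ|` over the `i, j` with `lamᵢⱼ ≠ 1`. -/
noncomputable def weightRadius {n p : ℕ} (lam : Fin n → Fin p → ℝ) : ENNReal :=
  ⨆ (i : Fin n) (j : Fin p) (_ : lam i j ≠ 1), ‖lam i j‖ₑ

/-- The total number of nonzero weights. -/
noncomputable def totalCard {n p : ℕ} (lam : Fin n → Fin p → ℝ) : ℕ :=
  ∑ i, {j | lam i j ≠ 0}.ncard

/-- `s = n + 1 + 2 m c / (γ² + c)`. -/
noncomputable def sparsity (n m : ℕ) (c γ : ℝ) : ℝ := n + 1 + 2 * m * (c / (γ ^ 2 + c))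

/-!
Existence: `epiHull` is cut out by the Lagrangian inequalities, so it contains `(dualValue, 0)`. By
the Shapley–Folkman theorem, every point of the convex hull of `epiSet` dominates a representation
with at most `n + m + 1` nonzero weights, and by compactness so does every point of the closure;
a feasible point below `(dualValue, 0)` attains the dual minimum.

Sparsification: if `n + m + 1` is already below the target `s`, nothing has to be done. Otherwise
sample among the fractional weights, of which there are at most `2 m + 2`, and renormalize the rows;
the second moment method bounds the displacement caused by the sampling, and `M_V` bounds the one
caused by the renormalization.

Gap: replace each row of the sparse representation by its barycenter. A row with `β` nonzero weights
loses at most `ρ_β` in the objective, and only the at most `m + 1` rows with two or more nonzero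
weights lose anything, at most `ρ̄_g`, in the constraints.
-/

section BasicSolutions

open Finset Module Function

variable {𝕜 T E : Type*} [Field 𝕜] [LinearOrder 𝕜] [IsStrictOrderedRing 𝕜] [Fintype T]
  [AddCommGroup E] [Module 𝕜 E] {a : T → E} {l : E →ₗ[𝕜] 𝕜}

theorem exists_linear_relation_with_neg (hl : ∀ t, l (a t) = 1) (c : T → 𝕜) {s : Finset T}
    (hs : ¬LinearIndepOn 𝕜 a s) :
    ∃ g : T → 𝕜, ∑ t, g t • a t = 0 ∧ ∑ t, g t * c t ≤ 0 ∧ (∀ t ∉ s, g t = 0) ∧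
      ∃ t, g t < 0 := by
  classical
  obtain ⟨g, hg, t₀, ht₀, hne⟩ := not_linearIndepOn_finset_iff.1 hs
  let g₁ : T → 𝕜 := fun t => if t ∈ s then g t else 0
  have hg₁ : ∑ t, g₁ t • a t = 0 := by simpa [g₁, ite_smul, sum_ite_mem] using hg
  obtain ⟨ε, hε, hcost⟩ : ∃ ε : 𝕜, ε ≠ 0 ∧ ε * ∑ t, g₁ t * c t ≤ 0 := by
    rcases le_total (∑ t, g₁ t * c t) 0 with h | h
    · exact ⟨1, one_ne_zero, by simpa using h⟩
    · exact ⟨-1, by simp, by simpa using h⟩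
  have hsum : ∑ t, g₁ t = 0 := by simpa [hl] using congrArg l hg₁
  refine ⟨fun t => ε * g₁ t, ?_, ?_, fun t ht => by simp [g₁, ht], ?_⟩
  · simp only [mul_smul, ← smul_sum, hg₁, smul_zero]
  · simpa only [mul_assoc, ← mul_sum] using hcost
  · by_contra! hnonneg
    have hzero := (sum_eq_zero_iff_of_nonneg fun t _ => hnonneg t).1
      (by rw [← mul_sum, hsum, mul_zero]) t₀ (mem_univ _)
    simp [g₁, ht₀, hne, hε] at hzero

theorem exists_weights_support_ssubset (hl : ∀ t, l (a t) = 1) (c : T → 𝕜) {μ : T → 𝕜}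
    (hμ : ∀ t, 0 ≤ μ t) (hdep : ¬LinearIndepOn 𝕜 a (support μ)) :
    ∃ α : T → 𝕜, (∀ t, 0 ≤ α t) ∧ ∑ t, α t • a t = ∑ t, μ t • a t ∧
      ∑ t, α t * c t ≤ ∑ t, μ t * c t ∧ support α ⊂ support μ := by
  classical
  obtain ⟨g, hg, hgc, hgs, hneg⟩ := exists_linear_relation_with_neg (s := {t | μ t ≠ 0}) hl c
    (by rw [coe_filter_univ]; exact hdep)
  have hgμ : ∀ t, μ t = 0 → g t = 0 := fun t ht => hgs t (by simp [ht])
  obtain ⟨t₀, ht₀, hmin⟩ :=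
    exists_min_image {t | g t < 0} (fun t => μ t / (-g t)) (by simpa [Finset.Nonempty] using hneg)
  simp only [mem_filter_univ] at ht₀ hmin
  set r := μ t₀ / (-g t₀) with hr
  have hr₀ : 0 ≤ r := div_nonneg (hμ _) (by linarith)
  have hvanish : μ t₀ + r * g t₀ = 0 := by
    rw [hr]
    field_simp [ht₀.ne]
    simp
  refine ⟨fun t => μ t + r * g t, fun t => ?_, ?_, ?_, ?_⟩
  · rcases lt_or_ge (g t) 0 with h | h
    · have := (le_div_iff₀ (by linarith)).1 (hmin t h)
      linarith
    · have := hμ t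
      positivity
  · simp only [add_smul, sum_add_distrib, mul_smul, ← smul_sum, hg, smul_zero, add_zero]
  · simp only [add_mul, sum_add_distrib, mul_assoc, ← mul_sum]
    nlinarith
  · refine (Set.ssubset_iff_of_subset ?_).2
      ⟨t₀, fun h => ht₀.ne (hgμ _ h), not_not.2 hvanish⟩
    exact fun t ht h => ht (by simp [h, hgμ t h])

theorem exists_weights_linearIndepOn_support (hl : ∀ t, l (a t) = 1) (c : T → 𝕜) {μ : T → 𝕜}
    (hμ : ∀ t, 0 ≤ μ t) :
    ∃ α : T → 𝕜, (∀ t, 0 ≤ α t) ∧ ∑ t, α t • a t = ∑ t, μ t • a t ∧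
      ∑ t, α t * c t ≤ ∑ t, μ t * c t ∧ support α ⊆ support μ ∧
      LinearIndepOn 𝕜 a (support α) := by
  induction hs : support μ using WellFoundedLT.induction generalizing μ with
  | ind s ih =>
    subst hs
    by_cases hind : LinearIndepOn 𝕜 a (support μ)
    · exact ⟨μ, hμ, rfl, le_rfl, subset_rfl, hind⟩
    · obtain ⟨α, hα, hαa, hαc, hαs⟩ := exists_weights_support_ssubset hl c hμ hind
      obtain ⟨β, hβ, hβa, hβc, hβs, hβind⟩ := ih _ hαs hα rfl
      exact ⟨β, hβ, hβa.trans hαa, hβc.trans hαc, hβs.trans hαs.subset, hβind⟩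

end BasicSolutions

section ConvexWeights

open Finset Module

variable {ι T E : Type*} [Fintype ι] [Fintype T] [AddCommGroup E] [Module ℝ E]

theorem ncard_setOf_ne_zero (w : T → ℝ) : {t | w t ≠ 0}.ncard = #{t | w t ≠ 0} := by
  rw [← Set.ncard_coe_finset, coe_filter_univ]

theorem card_ne_zero_le_finrank [FiniteDimensional ℝ E] {a : T → E} {α : T → ℝ}
    (hα : LinearIndepOn ℝ a (Function.support α)) : #{t | α t ≠ 0} ≤ finrank ℝ E := by
  have h : LinearIndepOn ℝ a ({t | α t ≠ 0} : Finset T) := by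
    rw [coe_filter_univ]
    exact hα
  simpa using h.fintype_card_le_finrank

theorem shapley_folkman [FiniteDimensional ℝ E] (p : ι → T → E) {μ : ι → T → ℝ}
    (hμ : ∀ i, μ i ∈ stdSimplex ℝ T) :
    ∃ α : ι → T → ℝ, (∀ i, α i ∈ stdSimplex ℝ T) ∧
      ∑ i, ∑ t, α i t • p i t = ∑ i, ∑ t, μ i t • p i t ∧
      ∑ i, #{t | α i t ≠ 0} ≤ Fintype.card ι + finrank ℝ E := by
  classical
  let a : ι × T → E × (ι → ℝ) := fun q => (p q.1 q.2, Pi.single q.1 1)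
  let l : E × (ι → ℝ) →ₗ[ℝ] ℝ := (∑ i, LinearMap.proj i) ∘ₗ LinearMap.snd ℝ _ _
  obtain ⟨α, hα, hαa, -, -, hind⟩ :=
    exists_weights_linearIndepOn_support (a := a) (l := l) (fun q => by simp [l, a]) 0
      (μ := fun q => μ q.1 q.2) (fun q => (hμ q.1).1 q.2)
  have hfst := congrArg Prod.fst hαa
  have hsnd := congrArg Prod.snd hαa
  simp only [Prod.fst_sum, Prod.snd_sum, Prod.smul_fst, Prod.smul_snd, a,
    Fintype.sum_prod_type] at hfst hsnd
  refine ⟨fun i t => α (i, t), fun i => ⟨fun t => hα _, ?_⟩, hfst, ?_⟩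
  · simpa [Finset.sum_apply, Pi.single_apply, (hμ i).2] using congrFun hsnd i
  · have hcard := card_ne_zero_le_finrank hind
    rw [finrank_prod, finrank_pi, add_comm] at hcard
    simpa only [card_filter, Fintype.sum_prod_type] using hcard

theorem nonempty_of_mem_stdSimplex {w : T → ℝ} (hw : w ∈ stdSimplex ℝ T) :
    ({t | w t ≠ 0} : Finset T).Nonempty := by
  by_contra! h
  simp only [filter_eq_empty_iff, mem_univ, true_implies, not_not] at h
  simpa [h] using hw.2

theorem eq_single_of_card_ne_zero_le_one [DecidableEq T] {w : T → ℝ} (hw : w ∈ stdSimplex ℝ T)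
    (hcard : #{t | w t ≠ 0} ≤ 1) : ∃ t, w = Pi.single t 1 := by
  obtain ⟨t, ht⟩ := card_eq_one.1 (hcard.antisymm (nonempty_of_mem_stdSimplex hw).card_pos)
  have hzero : ∀ t' ≠ t, w t' = 0 := fun t' ht' => by
    by_contra h
    exact ht' (mem_singleton.1 (ht ▸ by simpa using h))
  have hone : w t = 1 := by rw [← hw.2, Fintype.sum_eq_single t hzero]
  exact ⟨t, funext fun t' => by
    rcases eq_or_ne t' t with rfl | h <;> simp [*]⟩

theorem sum_smul_comp_eq {κ : Type*} [Fintype κ] [DecidableEq T] {τ : κ → T} {ν : κ → ℝ}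
    {w : T → ℝ} (h : ∀ t, ∑ j with τ j = t, ν j = w t) (p : T → E) :
    ∑ j, ν j • p (τ j) = ∑ t, w t • p t := by
  rw [← sum_fiberwise univ τ]
  refine sum_congr rfl fun t _ => ?_
  rw [← h t, sum_smul]
  exact sum_congr rfl fun j hj => by rw [(mem_filter.1 hj).2]

theorem exists_fin_reindex [DecidableEq T] {w : T → ℝ} (hw : w ∈ stdSimplex ℝ T) {N : ℕ}
    (hN : #{t | w t ≠ 0} ≤ N) :
    ∃ (τ : Fin N → T) (ν : Fin N → ℝ), ν ∈ stdSimplex ℝ (Fin N) ∧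
      #{j | ν j ≠ 0} = #{t | w t ≠ 0} ∧ ∀ t, ∑ j with τ j = t, ν j = w t := by
  obtain ⟨t₀, -⟩ := nonempty_of_mem_stdSimplex hw
  let S : Finset T := {t | w t ≠ 0}
  obtain ⟨e⟩ : Nonempty (S ↪ Fin N) :=
    Function.Embedding.nonempty_of_card_le (by rwa [Fintype.card_coe, Fintype.card_fin])
  let τ : Fin N → T := Function.extend e Subtype.val fun _ => t₀
  let ν : Fin N → ℝ := Function.extend e (fun s => w s) 0
  have hτ (s : S) : τ (e s) = s := e.injective.extend_apply _ _ s
  have hν (s : S) : ν (e s) = w s := e.injective.extend_apply _ _ s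
  have hν₀ (j) (hj : j ∉ Set.range e) : ν j = 0 := Function.extend_apply' _ _ j hj
  have hfiber (t : T) : ∑ j with τ j = t, ν j = w t := by
    calc ∑ j with τ j = t, ν j = ∑ j, if τ j = t then ν j else 0 := sum_filter _ _
      _ = ∑ s : S, if (s : T) = t then w s else 0 :=
        (Fintype.sum_of_injective e e.injective _ _ (fun j hj => by simp [hν₀ j hj])
          fun s => by simp only [hτ, hν]).symm
      _ = ∑ s ∈ S, if s = t then w s else 0 := sum_coe_sort S fun s => if s = t then w s else 0
      _ = w t := by
        by_cases ht : w t = 0 <;> simp [S, ht]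
  refine ⟨τ, ν, ⟨fun j => ?_, ?_⟩, ?_, hfiber⟩
  · by_cases hj : j ∈ Set.range e
    · obtain ⟨s, rfl⟩ := hj
      exact hν s ▸ hw.1 s
    · exact (hν₀ j hj).ge
  · rw [← sum_fiberwise univ τ, ← hw.2]
    exact sum_congr rfl fun t _ => hfiber t
  · have : ({j | ν j ≠ 0} : Finset (Fin N)) = S.attach.map e := by
      ext j
      simp only [mem_filter_univ, mem_map, mem_attach, true_and]
      refine ⟨fun h => not_imp_comm.1 (hν₀ j) h, ?_⟩
      rintro ⟨s, rfl⟩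
      rw [hν]
      exact (mem_filter_univ s.1).1 s.2
    rw [this, card_map, card_attach]

end ConvexWeights

section FractionalWeights

open Finset

variable {T : Type*} [Fintype T]

/-- The indices of the weights other than `0` and `1`: the only entries of a vector of convex
weights which sparsification may change. -/
noncomputable def fractional (w : T → ℝ) : Finset T := {t | w t ≠ 0 ∧ w t ≠ 1}

theorem mem_fractional {w : T → ℝ} {t : T} : t ∈ fractional w ↔ w t ≠ 0 ∧ w t ≠ 1 := by
  simp [fractional]

theorem fractional_eq_of_one_lt_card {w : T → ℝ} (hw : w ∈ stdSimplex ℝ T)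
    (hcard : 1 < #{t | w t ≠ 0}) : fractional w = ({t | w t ≠ 0} : Finset T) := by
  classical
  ext t
  simp only [mem_fractional, mem_filter_univ, and_iff_left_iff_imp]
  intro _ hone
  obtain ⟨t', ht', hne⟩ := exists_mem_ne hcard t
  have hle : w t + w t' ≤ ∑ s, w s := by
    rw [← sum_pair hne.symm]
    exact sum_le_univ_sum_of_nonneg hw.1
  have : 0 < w t' := (hw.1 t').lt_of_ne' ((mem_filter_univ t').1 ht')
  linarith [hw.2]

theorem fractional_eq_empty_of_card_le_one {w : T → ℝ} (hw : w ∈ stdSimplex ℝ T)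
    (hcard : #{t | w t ≠ 0} ≤ 1) : fractional w = ∅ := by
  classical
  obtain ⟨t, rfl⟩ := eq_single_of_card_ne_zero_le_one hw hcard
  ext s
  rcases eq_or_ne s t with rfl | h <;> simp [mem_fractional, *]

theorem card_mul_ne_zero_le_one_add {w : T → ℝ} (hw : w ∈ stdSimplex ℝ T) (θ : T → ℝ) :
    #{t | θ t * w t ≠ 0} ≤ 1 + #{t ∈ fractional w | θ t ≠ 0} := by
  classical
  have hone : #{t | w t = 1} ≤ 1 := by
    have hle : ∑ t with w t = 1, w t ≤ ∑ t, w t := sum_le_univ_sum_of_nonneg hw.1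
    rw [hw.2, sum_congr rfl fun t ht => (mem_filter.1 ht).2, sum_const, nsmul_one] at hle
    exact_mod_cast hle
  calc #{t | θ t * w t ≠ 0}
      ≤ #(({t | w t = 1} : Finset T) ∪ {t ∈ fractional w | θ t ≠ 0}) := by
        refine card_le_card fun t ht => ?_
        simp only [mem_filter_univ, mul_ne_zero_iff] at ht
        simp only [mem_union, mem_filter, mem_fractional, mem_univ, true_and]
        tauto
    _ ≤ #{t | w t = 1} + #{t ∈ fractional w | θ t ≠ 0} := card_union_le _ _
    _ ≤ 1 + #{t ∈ fractional w | θ t ≠ 0} := by gcongr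

theorem card_ne_zero_le_one_add_card_fractional {w : T → ℝ} (hw : w ∈ stdSimplex ℝ T) :
    #{t | w t ≠ 0} ≤ 1 + #(fractional w) := by
  simpa using card_mul_ne_zero_le_one_add hw 1

theorem card_fractional_add_two_le {w : T → ℝ} (hw : w ∈ stdSimplex ℝ T) :
    #(fractional w) + 2 ≤ 2 * #{t | w t ≠ 0} := by
  have hpos := (nonempty_of_mem_stdSimplex hw).card_pos
  rcases le_or_gt #{t | w t ≠ 0} 1 with h | h
  · rw [fractional_eq_empty_of_card_le_one hw h, card_empty]
    omega
  · rw [fractional_eq_of_one_lt_card hw h]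
    omega

end FractionalWeights

section Sampling

open Finset

variable {ι H : Type*} [NormedAddCommGroup H] [InnerProductSpace ℝ H]

/- The mean of `‖X + (aᵢ - ā)‖²` is `‖X‖²` plus the variance, as the cross term averages to `0`. -/
theorem exists_norm_sq_add_sub_mean_le (s : Finset ι) {w : ι → ℝ} (hw : ∀ i ∈ s, 0 ≤ w i)
    (hsum : ∑ i ∈ s, w i = 1) (a : ι → H) (X : H) :
    ∃ i ∈ s, ‖X + (a i - ∑ j ∈ s, w j • a j)‖ ^ 2 ≤ ‖X‖ ^ 2 + ∑ j ∈ s, w j * ‖a j‖ ^ 2 := by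
  set mean := ∑ j ∈ s, w j • a j
  have hmean : ∑ i ∈ s, w i * ‖X + (a i - mean)‖ ^ 2 =
      ‖X‖ ^ 2 + ∑ i ∈ s, w i * ‖a i‖ ^ 2 - ‖mean‖ ^ 2 := by
    have hexpand (i) : w i * ‖X + (a i - mean)‖ ^ 2 = w i * ‖X - mean‖ ^ 2 +
        2 * inner ℝ (X - mean) (w i • a i) + w i * ‖a i‖ ^ 2 := by
      rw [show X + (a i - mean) = (X - mean) + a i by abel, norm_add_sq_real, inner_smul_right]
      ring
    simp only [hexpand, sum_add_distrib, ← sum_mul, ← mul_sum, ← inner_sum, hsum]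
    rw [norm_sub_sq_real, inner_sub_left, real_inner_self_eq_norm_sq]
    ring
  by_contra! hlt
  have := (convex_Ioi (‖X‖ ^ 2 + ∑ j ∈ s, w j * ‖a j‖ ^ 2)).sum_mem hw hsum hlt
  simp only [Set.mem_Ioi, smul_eq_mul, hmean] at this
  linarith [sq_nonneg ‖mean‖]

/-- Maurey's empirical method. -/
theorem exists_norm_sq_sum_sub_mean_le (s : Finset ι) {w : ι → ℝ} (hw : ∀ i ∈ s, 0 ≤ w i)
    (hsum : ∑ i ∈ s, w i = 1) (a : ι → H) (k : ℕ) :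
    ∃ j : Fin k → ι, (∀ l, j l ∈ s) ∧
      ‖∑ l, (a (j l) - ∑ i ∈ s, w i • a i)‖ ^ 2 ≤ k * ∑ i ∈ s, w i * ‖a i‖ ^ 2 := by
  induction k with
  | zero => exact ⟨Fin.elim0, fun l => l.elim0, by simp⟩
  | succ k ih =>
    obtain ⟨j, hj, hbound⟩ := ih
    obtain ⟨i, hi, hstep⟩ := exists_norm_sq_add_sub_mean_le s hw hsum a
      (∑ l, (a (j l) - ∑ i ∈ s, w i • a i))
    refine ⟨Fin.snoc j i, Fin.lastCases (by simpa using hi) (by simpa using hj), ?_⟩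
    simp only [Fin.sum_univ_castSucc, Fin.snoc_castSucc, Fin.snoc_last]
    push_cast
    linarith

theorem exists_sparse_reweighting [Fintype ι] {S : Finset ι} (hS : S.Nonempty) (a : ι → H) {C : ℝ}
    (ha : ∀ i ∈ S, ‖a i‖ ^ 2 ≤ C) {k : ℕ} (hk : 0 < k) :
    ∃ θ : ι → ℝ, (∀ i, 0 ≤ θ i) ∧ #{i ∈ S | θ i ≠ 0} ≤ k ∧ (∀ i ∉ S, θ i = 1) ∧
      ‖∑ i, (θ i - 1) • a i‖ ^ 2 ≤ #S ^ 2 * C / k := by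
  classical
  have hS₀ : (0 : ℝ) < #S := by exact_mod_cast hS.card_pos
  have : (0 : ℝ) < k := by exact_mod_cast hk
  obtain ⟨j, hj, hbound⟩ := exists_norm_sq_sum_sub_mean_le S (w := fun _ => (#S : ℝ)⁻¹)
    (fun _ _ => by positivity) (by simp [hS₀.ne']) a k
  let θ : ι → ℝ := fun i => if i ∈ S then #S * #{l | j l = i} / k else 1
  have hθS (i) (hi : i ∈ S) : θ i = #S * #{l | j l = i} / k := if_pos hi
  have hθ (i) (hi : i ∉ S) : θ i = 1 := if_neg hi
  refine ⟨θ, fun i => ?_, ?_, hθ, ?_⟩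
  · by_cases hi : i ∈ S
    · rw [hθS i hi]
      positivity
    · simp [hθ i hi]
  · calc #{i ∈ S | θ i ≠ 0} ≤ #(univ.image j) := by
          refine card_le_card fun i hi => ?_
          obtain ⟨hi, hne⟩ := mem_filter.1 hi
          by_contra! hmem
          simp only [mem_image, mem_univ, true_and, not_exists] at hmem
          simp [hθS i hi, hmem] at hne
      _ ≤ k := card_image_le.trans (by simp)
  · have hsum : ∑ i, (θ i - 1) • a i =
        ((#S : ℝ) / k) • ∑ l, (a (j l) - ∑ i ∈ S, (#S : ℝ)⁻¹ • a i) := by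
      rw [← sum_subset (subset_univ S) fun i _ hi => by simp [hθ i hi], sum_sub_distrib,
        ← sum_fiberwise_of_maps_to' (fun l _ => hj l), ← smul_sum]
      simp only [sum_const, ← Nat.cast_smul_eq_nsmul ℝ, card_univ, Fintype.card_fin, smul_sub,
        smul_sum, smul_smul, sub_smul, sum_sub_distrib]
      congr 1 <;> refine sum_congr rfl fun i hi => ?_
      · rw [hθS i hi, div_mul_eq_mul_div]
      · congr 1
        field_simp
    calc ‖∑ i, (θ i - 1) • a i‖ ^ 2
        ≤ (#S / k) ^ 2 * (k * ∑ i ∈ S, (#S : ℝ)⁻¹ * ‖a i‖ ^ 2) := by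
          rw [hsum, norm_smul, mul_pow, Real.norm_of_nonneg (by positivity)]
          gcongr
      _ ≤ (#S / k) ^ 2 * (k * ∑ _ ∈ S, (#S : ℝ)⁻¹ * C) := by
          gcongr with _ hi
          exact ha _ hi
      _ = #S ^ 2 * C / k := by
          rw [sum_const, nsmul_eq_mul]
          field_simp

end Sampling

section WithLpSums

theorem withLp_sum_fst {ι V W : Type*} [AddCommGroup V] [AddCommGroup W] (s : Finset ι)
    (z : ι → WithLp 2 (V × W)) : (∑ i ∈ s, z i).fst = ∑ i ∈ s, (z i).fst :=
  map_sum (⟨⟨WithLp.fst, WithLp.zero_fst⟩, WithLp.add_fst⟩ : WithLp 2 (V × W) →+ V) z s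

theorem withLp_sum_snd {ι V W : Type*} [AddCommGroup V] [AddCommGroup W] (s : Finset ι)
    (z : ι → WithLp 2 (V × W)) : (∑ i ∈ s, z i).snd = ∑ i ∈ s, (z i).snd :=
  map_sum (⟨⟨WithLp.snd, WithLp.zero_snd⟩, WithLp.add_snd⟩ : WithLp 2 (V × W) →+ W) z s

end WithLpSums

section Sparsification

open Finset

variable {ι T : Type*} [Fintype T]

theorem pi_sum_smul_mem [Finite ι] {E : ι → Type*} [∀ i, AddCommGroup (E i)] [∀ i, Module ℝ (E i)]
    {S : Set (∀ i, E i)} (hS : Convex ℝ S) {z : ∀ i, T → E i}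
    (hz : ∀ κ : ι → T, (fun i => z i (κ i)) ∈ S) {μ : ι → T → ℝ}
    (hμ : ∀ i, μ i ∈ stdSimplex ℝ T) : (fun i => ∑ t, μ i t • z i t) ∈ S := by
  have hpi : (fun i => ∑ t, μ i t • z i t) ∈
      convexHull ℝ (Set.univ.pi fun i => Set.range (z i)) := by
    rw [convexHull_pi]
    exact fun i _ => mem_convexHull_of_exists_fintype (μ i) (z i) (hμ i).1 (hμ i).2
      (fun t => ⟨t, rfl⟩) rfl
  refine convexHull_min (fun p hp => ?_) hS hpi
  choose κ hκ using fun i => hp i (Set.mem_univ i)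
  exact (funext hκ : (fun i => z i (κ i)) = p) ▸ hz κ

variable [Fintype ι]

theorem norm_sum_smul_sum_le {E : Type*} [NormedAddCommGroup E] [NormedSpace ℝ E]
    {z : ι → T → E} {δ : ι → ℝ} {C : ℝ} (hC : ∀ κ : ι → T, ‖∑ i, δ i • z i (κ i)‖ ≤ C)
    {μ : ι → T → ℝ} (hμ : ∀ i, μ i ∈ stdSimplex ℝ T) :
    ‖∑ i, δ i • ∑ t, μ i t • z i t‖ ≤ C := by
  let F : (ι → E) →ₗ[ℝ] E := ∑ i, δ i • LinearMap.proj i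
  have hF (p : ι → E) : F p = ∑ i, δ i • p i := by simp [F]
  have := pi_sum_smul_mem ((convex_closedBall (0 : E) C).linear_preimage F) (z := z)
    (fun κ => by simpa [hF] using hC κ) hμ
  simpa [hF] using this

theorem exists_stdSimplex_sum_smul_eq {w : T → ℝ} (hw : ∀ t, 0 ≤ w t) (t₀ : T) :
    ∃ μ ∈ stdSimplex ℝ T, (∑ t, w t) • μ = w ∧ (∀ t ≠ t₀, w t = 0 → μ t = 0) ∧
      #{t | μ t ≠ 0} ≤ max 1 #{t | w t ≠ 0} := by
  classical
  rcases (sum_nonneg fun t _ => hw t).eq_or_lt with h | h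
  · have hzero : w = 0 := funext fun t =>
      (sum_eq_zero_iff_of_nonneg fun t _ => hw t).1 h.symm t (mem_univ t)
    refine ⟨Pi.single t₀ 1, single_mem_stdSimplex ℝ t₀, by simp [hzero],
      fun t ht _ => Pi.single_eq_of_ne ht 1, ?_⟩
    have : ({t | (Pi.single t₀ 1 : T → ℝ) t ≠ 0} : Finset T) = {t₀} := by
      ext t
      simp [Pi.single_apply]
    simp [this]
  · refine ⟨(∑ t, w t)⁻¹ • w, ⟨fun t => ?_, ?_⟩, smul_inv_smul₀ h.ne' w,
      fun t _ ht => by simp [ht], ?_⟩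
    · exact mul_nonneg (inv_nonneg.2 h.le) (hw t)
    · simp [← mul_sum, h.ne']
    · simp [h.ne']

theorem exists_sparse_rows_reweighting {H : Type*} [NormedAddCommGroup H] [InnerProductSpace ℝ H]
    {S : ι → Finset T} (hS : 0 < ∑ i, #(S i)) (a : ι → T → H) {C : ℝ}
    (ha : ∀ i, ∀ t ∈ S i, ‖a i t‖ ^ 2 ≤ C) {k : ℕ} (hk : 0 < k) :
    ∃ θ : ι → T → ℝ, (∀ i t, 0 ≤ θ i t) ∧ ∑ i, #{t ∈ S i | θ i t ≠ 0} ≤ k ∧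
      ‖∑ i, ∑ t, (θ i t - 1) • a i t‖ ^ 2 ≤ (∑ i, #(S i) : ℕ) ^ 2 * C / k := by
  classical
  let S' : Finset (ι × T) := {q | q.2 ∈ S q.1}
  have hcard (p : ι → T → Prop) [∀ i t, Decidable (p i t)] :
      #{q ∈ S' | p q.1 q.2} = ∑ i, #{t ∈ S i | p i t} := by
    simp only [S', filter_filter, card_filter, Fintype.sum_prod_type]
    simp only [← card_filter, ← filter_filter, filter_univ_mem]
  have hS' : #S' = ∑ i, #(S i) := by simpa using hcard fun _ _ => True
  obtain ⟨θ, hθ, hθk, -, hbound⟩ := exists_sparse_reweighting (card_pos.1 (hS' ▸ hS))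
    (fun q : ι × T => a q.1 q.2) (fun q hq => ha _ _ ((mem_filter_univ q).1 hq)) hk
  rw [hS', Fintype.sum_prod_type] at hbound
  exact ⟨fun i t => θ (i, t), fun i t => hθ _, (hcard fun i t => θ (i, t) ≠ 0).symm.trans_le hθk,
    hbound⟩

theorem exists_sparse_perturbation {E : Type*} [NormedAddCommGroup E] [InnerProductSpace ℝ E]
    (z : ι → T → E) {lam : ι → T → ℝ} (hlam : ∀ i, lam i ∈ stdSimplex ℝ T) (M : ℝ) {R Λ : ℝ}
    (hR : ∀ i, ∀ t ∈ fractional (lam i), ‖lam i t • z i t‖ ≤ R)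
    (hΛ : ∀ i, ∀ t ∈ fractional (lam i), lam i t ≤ Λ)
    (hpos : 0 < ∑ i, #(fractional (lam i))) {k : ℕ} (hk : 0 < k) :
    ∃ θ : ι → T → ℝ, (∀ i t, 0 ≤ θ i t) ∧
      ∑ i, #{t ∈ fractional (lam i) | θ i t ≠ 0} ≤ k ∧
      ‖∑ i, ∑ t, (θ i t * lam i t - lam i t) • z i t‖ ^ 2 +
          ∑ i, (M * (∑ t, θ i t * lam i t - 1)) ^ 2 ≤
        (∑ i, #(fractional (lam i)) : ℕ) ^ 2 * (R ^ 2 + M ^ 2 * Λ ^ 2) / k := by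
  classical
  let a : ι → T → WithLp 2 (E × EuclideanSpace ℝ ι) := fun i t =>
    lam i t • WithLp.toLp 2 (z i t, EuclideanSpace.single i M)
  have ha : ∀ i, ∀ t ∈ fractional (lam i), ‖a i t‖ ^ 2 ≤ R ^ 2 + M ^ 2 * Λ ^ 2 := by
    intro i t ht
    have hz := hR i t ht
    have hw := hΛ i t ht
    have hw₀ := (hlam i).1 t
    calc ‖a i t‖ ^ 2 = ‖lam i t • z i t‖ ^ 2 + M ^ 2 * lam i t ^ 2 := by
          simp only [a, WithLp.prod_norm_sq_eq_of_L2, WithLp.smul_fst, WithLp.smul_snd,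
            WithLp.toLp_fst, WithLp.toLp_snd]
          rw [norm_smul (lam _ _) (EuclideanSpace.single _ _), PiLp.norm_single, mul_pow,
            Real.norm_eq_abs, Real.norm_eq_abs, sq_abs, sq_abs, mul_comm (M ^ 2)]
      _ ≤ R ^ 2 + M ^ 2 * Λ ^ 2 := by gcongr
  obtain ⟨θ, hθ, hθk, hbound⟩ := exists_sparse_rows_reweighting hpos a ha hk
  refine ⟨θ, hθ, hθk, ?_⟩
  have hfst : (∑ i, ∑ t, (θ i t - 1) • a i t).fst =
      ∑ i, ∑ t, (θ i t * lam i t - lam i t) • z i t := by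
    simp only [withLp_sum_fst, a, WithLp.smul_fst, WithLp.toLp_fst, smul_smul, sub_mul, one_mul]
  have hsnd (i) : (∑ i, ∑ t, (θ i t - 1) • a i t).snd i = M * (∑ t, θ i t * lam i t - 1) := by
    simp [withLp_sum_snd, a, Pi.single_apply, ← mul_assoc, ← sum_mul, sub_mul, sum_sub_distrib,
      (hlam i).2, mul_comm M]
  simpa only [WithLp.prod_norm_sq_eq_of_L2, EuclideanSpace.real_norm_sq_eq, hfst, hsnd]
    using hbound

theorem sub_one_smul_sum_smul {E : Type*} [AddCommGroup E] [Module ℝ E] {c : ℝ} {μ w : T → ℝ}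
    (h : c • μ = w) (z : T → E) :
    (c - 1) • ∑ t, μ t • z t = ∑ t, w t • z t - ∑ t, μ t • z t := by
  rw [sub_smul, one_smul, smul_sum, ← h]
  simp only [smul_smul, Pi.smul_apply, smul_eq_mul]

theorem exists_sparse_weights {E : Type*} [NormedAddCommGroup E] [InnerProductSpace ℝ E]
    (z : ι → T → E) {lam : ι → T → ℝ} (hlam : ∀ i, lam i ∈ stdSimplex ℝ T) {M R Λ : ℝ}
    (hMz : ∀ (δ : EuclideanSpace ℝ ι) (κ : ι → T), ‖∑ i, δ i • z i (κ i)‖ ≤ M * ‖δ‖)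
    (hR : ∀ i, ∀ t ∈ fractional (lam i), ‖lam i t • z i t‖ ≤ R)
    (hΛ : ∀ i, ∀ t ∈ fractional (lam i), lam i t ≤ Λ)
    (hpos : 0 < ∑ i, #(fractional (lam i))) {k : ℕ} (hk : 0 < k) :
    ∃ μ : ι → T → ℝ, (∀ i, μ i ∈ stdSimplex ℝ T) ∧ (∀ i t, lam i t = 0 → μ i t = 0) ∧
      ∑ i, #{t | μ i t ≠ 0} ≤ Fintype.card ι + k ∧
      ‖∑ i, ∑ t, μ i t • z i t - ∑ i, ∑ t, lam i t • z i t‖ ^ 2 ≤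
        2 * (∑ i, #(fractional (lam i)) : ℕ) ^ 2 * (R ^ 2 + M ^ 2 * Λ ^ 2) / k := by
  classical
  obtain ⟨θ, hθ, hθk, hbound⟩ := exists_sparse_perturbation z hlam M hR hΛ hpos hk
  choose t₀ ht₀ using fun i => nonempty_of_mem_stdSimplex (hlam i)
  choose μ hμ hμθ hμ₀ hμcard using fun i =>
    exists_stdSimplex_sum_smul_eq (fun t => mul_nonneg (hθ i t) ((hlam i).1 t)) (t₀ i)
  set δ : EuclideanSpace ℝ ι := WithLp.toLp 2 fun i => ∑ t, θ i t * lam i t - 1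
  set e := ∑ i, ∑ t, (θ i t * lam i t - lam i t) • z i t
  refine ⟨μ, hμ, fun i t ht => hμ₀ i t ?_ (by simp [ht]), ?_, ?_⟩
  · rintro rfl
    exact (mem_filter_univ (t₀ i)).1 (ht₀ i) ht
  · calc ∑ i, #{t | μ i t ≠ 0} ≤ ∑ i, (1 + #{t ∈ fractional (lam i) | θ i t ≠ 0}) :=
          sum_le_sum fun i _ => (hμcard i).trans
            (max_le (Nat.le_add_right _ _) (card_mul_ne_zero_le_one_add (hlam i) (θ i)))
      _ = Fintype.card ι + ∑ i, #{t ∈ fractional (lam i) | θ i t ≠ 0} := by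
          simp [sum_add_distrib]
      _ ≤ Fintype.card ι + k := by gcongr
  · have hsplit : ∑ i, ∑ t, μ i t • z i t - ∑ i, ∑ t, lam i t • z i t =
        e - ∑ i, δ i • ∑ t, μ i t • z i t := by
      have hδ (i) : δ i • ∑ t, μ i t • z i t = _ := sub_one_smul_sum_smul (hμθ i) (z i)
      simp only [e, hδ, sub_smul, sum_sub_distrib]
      abel
    have hδ : ∑ i, (M * (∑ t, θ i t * lam i t - 1)) ^ 2 = (M * ‖δ‖) ^ 2 := by
      simp only [mul_pow, ← mul_sum, EuclideanSpace.real_norm_sq_eq, δ]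
    rw [hδ] at hbound
    calc _ ≤ (‖e‖ + M * ‖δ‖) ^ 2 := by
          rw [hsplit]
          gcongr
          exact (norm_sub_le _ _).trans (by gcongr; exact norm_sum_smul_sum_le (hMz δ) hμ)
      _ ≤ 2 * (‖e‖ ^ 2 + (M * ‖δ‖) ^ 2) := add_sq_le
      _ ≤ _ := by
          rw [mul_assoc, mul_div_assoc]
          gcongr

end Sparsification

section Semicontinuity

theorem lowerSemicontinuousOn_mul {X : Type*} [TopologicalSpace X] {s : Set X} {l h : X → ℝ}
    (hl : ContinuousOn l s) (hl₀ : ∀ x ∈ s, 0 ≤ l x) (hh : LowerSemicontinuousOn h s)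
    (hbdd : BddBelow (h '' s)) : LowerSemicontinuousOn (fun x => l x * h x) s := by
  obtain ⟨B, hB⟩ := hbdd
  intro x hx y hy
  have hlim (c : ℝ) (hc : y < l x * c) : ∀ᶠ z in nhdsWithin x s, y < l z * c :=
    ((hl x hx).mul_const c).eventually (lt_mem_nhds hc)
  rcases (hl₀ x hx).eq_or_lt with h₀ | h₀
  · have hy' : y < l x * B := by simpa [← h₀] using hy
    filter_upwards [hlim B hy', self_mem_nhdsWithin] with z hz hzs
    exact hz.trans_le (mul_le_mul_of_nonneg_left (hB ⟨z, hzs, rfl⟩) (hl₀ z hzs))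
  · obtain ⟨c, hyc, hch⟩ := exists_between ((div_lt_iff₀' h₀).2 hy)
    filter_upwards [hlim c ((div_lt_iff₀' h₀).1 hyc), hh x hx c hch, self_mem_nhdsWithin]
      with z hz hcz hzs
    exact hz.trans_le (mul_le_mul_of_nonneg_left hcz.le (hl₀ z hzs))

theorem isClosed_setOf_exists_mem_forall_le {X Z κ : Type*} [TopologicalSpace X] [T2Space X]
    [TopologicalSpace Z] {K : Set X} (hK : IsCompact K) {Φ : κ → X → ℝ}
    (hΦ : ∀ k, LowerSemicontinuousOn (Φ k) K) {ψ : κ → Z → ℝ} (hψ : ∀ k, Continuous (ψ k)) :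
    IsClosed {z | ∃ x ∈ K, ∀ k, Φ k x ≤ ψ k z} := by
  have : CompactSpace K := isCompact_iff_compactSpace.1 hK
  have hgraph : IsClosed {p : K × Z | ∀ k, Φ k p.1 ≤ ψ k p.2} := by
    rw [Set.ofPred_forall]
    refine isClosed_iInter fun k => ?_
    have hepi := (lowerSemicontinuousOn_iff_isClosed_epigraph hK.isClosed).1 (hΦ k)
    have hcont : Continuous fun p : K × Z => ((p.1 : X), ψ k p.2) := by fun_prop
    simpa using hepi.preimage hcont
  convert isClosedMap_snd_of_compactSpace _ hgraph using 1
  ext z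
  simp

theorem lowerSemicontinuousOn_sum_mul {ι T : Type*} [Fintype ι] [Fintype T] {X : ι → Type*}
    [∀ i, TopologicalSpace (X i)] {Y : ∀ i, Set (X i)} (hY : ∀ i, IsCompact (Y i))
    {h : ∀ i, X i → ℝ} (hh : ∀ i, LowerSemicontinuousOn (h i) (Y i)) :
    LowerSemicontinuousOn
      (fun p : (∀ i, T → X i) × (ι → T → ℝ) => ∑ i, ∑ t, p.2 i t * h i (p.1 i t))
      {p | (∀ i t, p.1 i t ∈ Y i) ∧ ∀ i t, 0 ≤ p.2 i t} := by
  refine lowerSemicontinuousOn_sum fun i _ => lowerSemicontinuousOn_sum fun t _ => ?_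
  refine lowerSemicontinuousOn_mul (by fun_prop) (fun p hp => hp.2 i t) ?_ ?_
  · exact (hh i).comp (by fun_prop) fun p hp => hp.1 i t
  · refine ((hh i).bddBelow_of_isCompact (hY i)).mono ?_
    rintro _ ⟨p, hp, rfl⟩
    exact ⟨p.1 i t, hp.1 i t, rfl⟩

end Semicontinuity

section Conjugates

open Finset Module

variable {d : ℕ} {φ : Vec d → EReal}

theorem ereal_coe_sum {ι : Type*} [Fintype ι] (a : ι → ℝ) :
    ((∑ i, a i : ℝ) : EReal) = ∑ i, (a i : EReal) :=
  map_sum (⟨⟨Real.toEReal, EReal.coe_zero⟩, EReal.coe_add⟩ : ℝ →+ EReal) a univ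

theorem fenchelConj_le_coe_iff {y : Vec d} {r : ℝ} :
    fenchelConj φ y ≤ r ↔ ∀ x, ((inner ℝ y x - r : ℝ) : EReal) ≤ φ x := by
  refine iSup_le_iff.trans (forall_congr' fun x => ?_)
  rw [EReal.coe_sub,
    EReal.sub_le_iff_le_add (.inr (EReal.coe_ne_top r)) (.inr (EReal.coe_ne_bot r)),
    EReal.sub_le_iff_le_add (.inl (EReal.coe_ne_bot r)) (.inl (EReal.coe_ne_top r)), add_comm]

theorem biconj_le_iff {x : Vec d} {c : EReal} :
    biconj φ x ≤ c ↔ ∀ (y : Vec d) (r : ℝ),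
      (∀ x', ((inner ℝ y x' - r : ℝ) : EReal) ≤ φ x') → ((inner ℝ y x - r : ℝ) : EReal) ≤ c := by
  simp only [← fenchelConj_le_coe_iff]
  refine iSup_le_iff.trans (forall_congr' fun y => ?_)
  rw [real_inner_comm]
  refine ⟨fun h r hr => le_trans ?_ h, fun h => ?_⟩
  · rw [EReal.coe_sub]
    exact EReal.sub_le_sub le_rfl hr
  · induction hc : fenchelConj φ y with
    | top => simp
    | coe r => exact EReal.coe_sub _ r ▸ h r hc.le
    | bot =>
      rw [EReal.coe_sub_bot, top_le_iff, EReal.eq_top_iff_forall_lt]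
      intro q
      refine lt_of_lt_of_le (EReal.coe_lt_coe_iff.2 ?_) (h (inner ℝ y x - (q + 1)) (hc ▸ bot_le))
      linarith

theorem biconj_le (φ : Vec d → EReal) (x : Vec d) : biconj φ x ≤ φ x :=
  biconj_le_iff.2 fun _ _ h => h x

theorem biconj_sum_smul_le {T : Type*} [Fintype T] {y : T → Vec d} {a : T → ℝ}
    (ha : ∀ t, φ (y t) ≤ a t) {μ : T → ℝ} (hμ : μ ∈ stdSimplex ℝ T) :
    biconj φ (∑ t, μ t • y t) ≤ ((∑ t, μ t * a t : ℝ) : EReal) := by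
  refine biconj_le_iff.2 fun q r h => EReal.coe_le_coe_iff.2 ?_
  calc inner ℝ q (∑ t, μ t • y t) - r = ∑ t, μ t * (inner ℝ q (y t) - r) := by
        simp only [inner_sum, inner_smul_right, mul_sub, sum_sub_distrib, ← sum_mul, hμ.2, one_mul]
    _ ≤ ∑ t, μ t * a t := sum_le_sum fun t _ =>
        mul_le_mul_of_nonneg_left (EReal.coe_le_coe_iff.1 ((h (y t)).trans (ha t))) (hμ.1 t)

theorem le_sum_add_rho {T : Type*} [Fintype T] {y : T → Vec d} {a : T → ℝ}
    (ha : ∀ t, φ (y t) ≤ a t) {μ : T → ℝ} (hμ : μ ∈ stdSimplex ℝ T)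
    (hdom : ∑ t, μ t • y t ∈ effDom φ) :
    φ (∑ t, μ t • y t) ≤ ((∑ t, μ t * a t : ℝ) : EReal) + rho φ := by
  rw [add_comm, ← EReal.sub_le_iff_le_add (.inl (EReal.coe_ne_bot _)) (.inl (EReal.coe_ne_top _))]
  exact (EReal.sub_le_sub le_rfl (biconj_sum_smul_le ha hμ)).trans (le_iSup₂_of_le _ hdom le_rfl)

theorem le_rhoK {k : ℕ} {y : Fin (d + 1) → Vec d} (hy : ∀ j, y j ∈ effDom φ)
    {α : Fin (d + 1) → ℝ} (hα : α ∈ stdSimplex ℝ (Fin (d + 1))) (hk : #{j | α j ≠ 0} ≤ k) :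
    φ (∑ j, α j • y j) - ((∑ j, α j * (φ (y j)).toReal : ℝ) : EReal) ≤ rhoK k φ :=
  le_iSup₂_of_le y α <| le_iSup_of_le ⟨hy, hα.1, hα.2, by rwa [ncard_setOf_ne_zero]⟩ le_rfl

/- By Carathéodory's theorem the bound `d + 1` on the number of points in `rhoK` is immaterial. -/
theorem le_sum_add_rhoK {T : Type*} [Fintype T] {k : ℕ} {y : T → Vec d} {a : T → ℝ}
    (ha : ∀ t, φ (y t) = a t) {μ : T → ℝ} (hμ : μ ∈ stdSimplex ℝ T) (hk : #{t | μ t ≠ 0} ≤ k) :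
    φ (∑ t, μ t • y t) ≤ ((∑ t, μ t * a t : ℝ) : EReal) + rhoK k φ := by
  classical
  obtain ⟨α, hα, hαy, hαa, hsupp, hind⟩ :=
    exists_weights_linearIndepOn_support (a := fun t => (y t, (1 : ℝ)))
      (l := LinearMap.snd ℝ (Vec d) ℝ) (fun _ => rfl) a hμ.1
  have hfst : ∑ t, α t • y t = ∑ t, μ t • y t := by simpa [Prod.fst_sum] using congrArg Prod.fst hαy
  have hsnd : ∑ t, α t = 1 := by
    simpa [Prod.snd_sum, hμ.2] using congrArg Prod.snd hαy
  have hcard := card_ne_zero_le_finrank hind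
  rw [finrank_prod, finrank_euclideanSpace_fin, finrank_self] at hcard
  obtain ⟨τ, ν, hν, hνcard, hfiber⟩ := exists_fin_reindex ⟨hα, hsnd⟩ hcard
  have hsub : ∀ t, α t ≠ 0 → μ t ≠ 0 := fun _ h => hsupp h
  have hνk : #{j | ν j ≠ 0} ≤ k :=
    hνcard.trans_le ((card_le_card (monotone_filter_right _ fun t _ => hsub t)).trans hk)
  have hgap := le_rhoK (fun j => (ha (τ j)).trans_lt (EReal.coe_lt_top _)) hν hνk
  simp only [ha, EReal.toReal_coe] at hgap
  rw [sum_smul_comp_eq hfiber y, hfst, EReal.sub_le_iff_le_add (.inl (EReal.coe_ne_bot _))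
    (.inl (EReal.coe_ne_top _)), add_comm] at hgap
  refine hgap.trans (add_le_add_left (EReal.coe_le_coe_iff.2 ?_) _)
  exact (sum_smul_comp_eq hfiber a).trans_le hαa

theorem rhoK_nonneg {x : Vec d} {r : ℝ} (hx : φ x = r) {k : ℕ} (hk : 1 ≤ k) : 0 ≤ rhoK k φ := by
  have h := le_sum_add_rhoK (φ := φ) (k := k) (y := fun _ : Unit => x) (a := fun _ => r)
    (fun _ => hx) (μ := fun _ => 1) (by simp [stdSimplex]) (by simpa using hk)
  simp only [univ_unique, one_smul, one_mul, sum_singleton, hx] at h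
  rwa [add_comm, ← EReal.sub_le_iff_le_add (.inl (EReal.coe_ne_bot r)) (.inl (EReal.coe_ne_top r)),
    EReal.sub_self (EReal.coe_ne_top r) (EReal.coe_ne_bot r)] at h

end Conjugates

section Coordinates

variable {m : ℕ}

/-- The coordinates of a point `(r₀, r)` of `ℝ^(1+m)`, indexed so that objective and constraints can
be treated at once: `none` stands for `r₀` and `some k` for `r k`. -/
noncomputable def valCoord (o : Option (Fin m)) : ValSpace m →L[ℝ] ℝ :=
  o.elim (WithLp.fstL 2 ℝ ℝ (Vec m)) fun k =>
    EuclideanSpace.proj k ∘L WithLp.sndL 2 ℝ ℝ (Vec m)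

theorem valCoord_none (z : ValSpace m) : valCoord none z = z.fst := rfl

theorem valCoord_some (k : Fin m) (z : ValSpace m) : valCoord (some k) z = z.snd k := rfl

theorem inner_toLp_eq (a : ℝ) (ν : Vec m) (z : ValSpace m) :
    inner ℝ (WithLp.toLp 2 (a, ν)) z = a * z.fst + ∑ k, ν k * z.snd k := by
  simp [WithLp.prod_inner_apply, PiLp.inner_apply, mul_comm]

theorem finrank_valSpace (m : ℕ) : Module.finrank ℝ (ValSpace m) = m + 1 := by
  rw [(WithLp.linearEquiv 2 ℝ (ℝ × Vec m)).finrank_eq, Module.finrank_prod,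
    finrank_euclideanSpace_fin, Module.finrank_self, add_comm]

theorem nonneg_of_forall_le_add_mul {v c₀ c : ℝ} (h : ∀ s, 0 ≤ s → v ≤ c₀ + s * c) : 0 ≤ c := by
  by_contra! hc
  have := h ((|c₀ - v| + 1) / -c) (div_nonneg (by positivity) (by linarith))
  have hs : (|c₀ - v| + 1) / -c * c = -(|c₀ - v| + 1) := by
    rw [div_neg, neg_mul, div_mul_cancel₀ _ hc.ne]
  linarith [le_abs_self (c₀ - v)]

end Coordinates

namespace SepProblem

variable {n m : ℕ} {d : Fin n → ℕ} {P : SepProblem n m d}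

/-- The standing assumptions in the form in which duality uses them: lower semicontinuous data, with
finite objective terms on nonempty compact sets. -/
structure IsRegular (P : SepProblem n m d) : Prop where
  lsc_f : ∀ i, LowerSemicontinuous (P.f i)
  lsc_g : ∀ i k, LowerSemicontinuous fun x => P.g i x k
  isCompact : ∀ i, IsCompact (P.Y i)
  nonempty : ∀ i, (P.Y i).Nonempty
  coe_f : ∀ i, ∀ x ∈ P.Y i, ((P.f i x).toReal : EReal) = P.f i x

theorem isRegular_of_isTame (hf : ∀ i, LowerSemicontinuous (P.f i))
    (hg : ∀ i k, LowerSemicontinuous fun x => P.g i x k) (hY : ∀ i, IsCompact (P.Y i))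
    (hdom : ∀ i, P.Y i ⊆ effDom (P.f i))
    (htame : ∀ i, IsTame fun x => P.fY i x + ((∑ k, P.g i x k : ℝ) : EReal)) : P.IsRegular where
  lsc_f := hf
  lsc_g := hg
  isCompact := hY
  nonempty i := by
    obtain ⟨x, hx⟩ := (htame i).dom_nonempty
    refine ⟨x, ?_⟩
    by_contra h
    simp [effDom, fY, extendTop, h] at hx
  coe_f i x hx := by
    refine EReal.coe_toReal (hdom i hx).ne fun h => ?_
    have := (htame i).ne_bot x
    simp [fY, extendTop, hx, h] at this

/-- The point `(∑ᵢ fᵢ(xᵢ), ∑ᵢ gᵢ(xᵢ) - b)`, the lowest one contributed by `x` to `epiSet`. -/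
noncomputable def outcome (P : SepProblem n m d) (x : ∀ i, Vec (d i)) : ValSpace m :=
  ∑ i, P.val i (x i) + WithLp.toLp 2 (0, -P.b)

theorem outcome_fst (x : ∀ i, Vec (d i)) : (P.outcome x).fst = ∑ i, (P.f i (x i)).toReal := by
  simp [outcome, withLp_sum_fst, val]

theorem outcome_snd (x : ∀ i, Vec (d i)) (k : Fin m) :
    (P.outcome x).snd k = ∑ i, P.g i (x i) k - P.b k := by
  simp [outcome, withLp_sum_snd, val, sub_eq_add_neg]

theorem lowerSemicontinuousOn_valCoord_val (hP : P.IsRegular) (o : Option (Fin m)) (i : Fin n) :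
    LowerSemicontinuousOn (fun x => valCoord o (P.val i x)) (P.Y i) := by
  rcases o with _ | k
  · intro x hx r hr
    have hfx : (r : EReal) < P.f i x := hP.coe_f i x hx ▸ EReal.coe_lt_coe_iff.2 hr
    filter_upwards [(hP.lsc_f i).lowerSemicontinuousOn _ x hx r hfx, self_mem_nhdsWithin]
      with y hy hyY
    exact EReal.coe_lt_coe_iff.1 ((hP.coe_f i y hyY).symm ▸ hy)
  · exact (hP.lsc_g i k).lowerSemicontinuousOn _

theorem exists_le_outcome_fst (hP : P.IsRegular) :
    ∃ B : ℝ, ∀ x : ∀ i, Vec (d i), (∀ i, x i ∈ P.Y i) → B ≤ (P.outcome x).fst := by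
  choose B hB using fun i =>
    (lowerSemicontinuousOn_valCoord_val hP none i).bddBelow_of_isCompact (hP.isCompact i)
  refine ⟨∑ i, B i, fun x hx => ?_⟩
  rw [outcome_fst]
  exact Finset.sum_le_sum fun i _ => hB i ⟨x i, hx i, rfl⟩

theorem sum_f_eq (hP : P.IsRegular) {x : ∀ i, Vec (d i)} (hx : ∀ i, x i ∈ P.Y i) :
    ∑ i, P.f i (x i) = (P.outcome x).fst := by
  rw [outcome_fst, ereal_coe_sum]
  exact Finset.sum_congr rfl fun i _ => (hP.coe_f i _ (hx i)).symm

theorem mem_epiSet_iff (hP : P.IsRegular) {z : ValSpace m} : z ∈ P.epiSet ↔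
    ∃ x : ∀ i, Vec (d i), (∀ i, x i ∈ P.Y i) ∧ ∀ o, valCoord o (P.outcome x) ≤ valCoord o z := by
  refine exists_congr fun x => and_congr_right fun hx => ?_
  simp only [sum_f_eq hP hx, EReal.coe_le_coe_iff, Option.forall, valCoord_none, valCoord_some,
    outcome_snd]

theorem outcome_mem_epiHull (hP : P.IsRegular) {x : ∀ i, Vec (d i)} (hx : ∀ i, x i ∈ P.Y i) :
    P.outcome x ∈ P.epiHull :=
  subset_closure <| subset_convexHull ℝ _ <| (mem_epiSet_iff hP).2 ⟨x, hx, fun _ => le_rfl⟩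

theorem le_Psi_iff (hP : P.IsRegular) {lam : Vec m} {r : ℝ} :
    (r : EReal) ≤ P.Psi lam ↔ ∀ x : ∀ i, Vec (d i), (∀ i, x i ∈ P.Y i) →
      r ≤ inner ℝ (WithLp.toLp 2 ((1 : ℝ), lam)) (P.outcome x) := by
  refine le_iInf₂_iff.trans (forall₂_congr fun x hx => ?_)
  rw [sum_f_eq hP hx, ← EReal.coe_add, EReal.coe_le_coe_iff, inner_toLp_eq, one_mul]
  simp only [outcome_snd]

theorem le_inner_of_mem_epiHull (hP : P.IsRegular) {lam : Vec m} (hlam : ∀ k, 0 ≤ lam k) {r : ℝ}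
    (hr : (r : EReal) ≤ P.Psi lam) {z : ValSpace m} (hz : z ∈ P.epiHull) :
    r ≤ inner ℝ (WithLp.toLp 2 ((1 : ℝ), lam)) z := by
  set v : ValSpace m := WithLp.toLp 2 (1, lam) with hv
  have hclosed : IsClosed {z | r ≤ inner ℝ v z} := isClosed_le continuous_const (by fun_prop)
  have hconvex : Convex ℝ {z | r ≤ inner ℝ v z} := convex_halfSpace_ge (innerₛₗ ℝ v).isLinear r
  refine closure_minimal (convexHull_min (fun z hz => ?_) hconvex) hclosed hz
  obtain ⟨x, hx, hxz⟩ := (mem_epiSet_iff hP).1 hz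
  refine ((le_Psi_iff hP).1 hr x hx).trans ?_
  simp only [inner_toLp_eq, hv, one_mul]
  exact add_le_add (hxz none) <| Finset.sum_le_sum fun k _ =>
    mul_le_mul_of_nonneg_left (hxz (some k)) (hlam k)

theorem exists_separating_of_notMem_epiHull (hP : P.IsRegular) {z : ValSpace m}
    (hz : z ∉ P.epiHull) : ∃ (a : ℝ) (ν : Vec m) (c : ℝ), 0 ≤ a ∧ (∀ k, 0 ≤ ν k) ∧
      inner ℝ (WithLp.toLp 2 (a, ν)) z < c ∧
      ∀ x : ∀ i, Vec (d i), (∀ i, x i ∈ P.Y i) →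
        c < inner ℝ (WithLp.toLp 2 (a, ν)) (P.outcome x) := by
  obtain ⟨F, c, hFz, hF⟩ := geometric_hahn_banach_point_closed
    (convex_convexHull ℝ P.epiSet).closure isClosed_closure hz
  choose x₀ hx₀ using hP.nonempty
  have hnonneg (v : ValSpace m) (hv : ∀ o, 0 ≤ valCoord o v) : 0 ≤ F v := by
    refine nonneg_of_forall_le_add_mul (v := c) (c₀ := F (P.outcome x₀)) fun s hs => ?_
    have hmem : P.outcome x₀ + s • v ∈ P.epiSet := (mem_epiSet_iff hP).2
      ⟨x₀, hx₀, fun o => by simpa using mul_nonneg hs (hv o)⟩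
    simpa using (hF _ (subset_closure (subset_convexHull ℝ _ hmem))).le
  obtain ⟨v, rfl⟩ := (InnerProductSpace.toDual ℝ (ValSpace m)).surjective F
  simp only [InnerProductSpace.toDual_apply_apply] at hFz hF hnonneg
  refine ⟨v.fst, v.snd, c, ?_, fun k => ?_, hFz, fun x hx => hF _ (outcome_mem_epiHull hP hx)⟩
  · have := hnonneg (WithLp.toLp 2 (1, 0)) (by rintro (_ | k) <;> simp [valCoord])
    simpa [WithLp.prod_inner_apply] using this
  · have := hnonneg (WithLp.toLp 2 (0, EuclideanSpace.single k 1)) (by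
      rintro (_ | l)
      · simp [valCoord]
      · simp only [valCoord_some, WithLp.toLp_snd, PiLp.single_apply]
        split_ifs <;> norm_num)
    simpa [WithLp.prod_inner_apply, EuclideanSpace.inner_single_right] using this

theorem mem_epiHull_iff (hP : P.IsRegular) {z : ValSpace m} : z ∈ P.epiHull ↔
    ∀ lam : Vec m, (∀ k, 0 ≤ lam k) →
      P.Psi lam ≤ ((z.fst + ∑ k, lam k * z.snd k : ℝ) : EReal) := by
  refine ⟨fun hz lam hlam => EReal.ge_of_forall_gt_iff_ge.1 fun r hr => ?_, fun h => ?_⟩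
  · have := le_inner_of_mem_epiHull hP hlam hr.le hz
    rw [inner_toLp_eq, one_mul] at this
    exact EReal.coe_le_coe_iff.2 this
  by_contra hz
  obtain ⟨a, ν, c, ha, hν, hz, hc⟩ := exists_separating_of_notMem_epiHull hP hz
  obtain ⟨B, hB⟩ := exists_le_outcome_fst hP
  /- The separating hyperplane may be vertical (`a = 0`); tilt it by a small `ε`, which costs
  little since the objective is bounded below. -/
  obtain ⟨ε, hε, hεz⟩ := exists_pos_mul_lt (sub_pos.2 hz) (z.fst - B)
  have hpos : 0 < a + ε := by linarith
  have hinner (z : ValSpace m) : inner ℝ (WithLp.toLp 2 ((1 : ℝ), (a + ε)⁻¹ • ν)) z =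
      (inner ℝ (WithLp.toLp 2 (a, ν)) z + ε * z.fst) / (a + ε) := by
    simp only [inner_toLp_eq, PiLp.smul_apply, smul_eq_mul, mul_assoc, ← Finset.mul_sum]
    field_simp
    ring
  have hPsi : (((c + ε * B) / (a + ε) : ℝ) : EReal) ≤ P.Psi ((a + ε)⁻¹ • ν) := by
    refine (le_Psi_iff hP).2 fun x hx => ?_
    rw [hinner]
    gcongr
    exacts [(hc x hx).le, hB x hx]
  have hle := hPsi.trans (h ((a + ε)⁻¹ • ν) fun k => mul_nonneg (by positivity) (hν k))
  rw [EReal.coe_le_coe_iff, ← one_mul z.fst, ← inner_toLp_eq, hinner,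
    div_le_div_iff_of_pos_right hpos] at hle
  linarith

end SepProblem

namespace SepProblem

variable {n m : ℕ} {d : Fin n → ℕ} {P : SepProblem n m d}

theorem le_hcP_iff (hP : P.IsRegular) {u : Vec m} {r : ℝ} :
    (r : EReal) ≤ P.hcP u ↔ ∀ x : ∀ i, Vec (d i), (∀ i, x i ∈ P.Y i) →
      (∀ k, (P.outcome x).snd k ≤ u k) → r ≤ (P.outcome x).fst := by
  refine le_iInf₂_iff.trans (forall_congr' fun x => and_imp.trans (forall_congr' fun hx => ?_))
  simp only [sum_f_eq hP hx, EReal.coe_le_coe_iff, outcome_snd]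

theorem affine_le_hcP_iff (hP : P.IsRegular) {y : Vec m} {r : ℝ} :
    (∀ u, ((inner ℝ y u - r : ℝ) : EReal) ≤ P.hcP u) ↔
      (∀ k, y k ≤ 0) ∧ ((-r : ℝ) : EReal) ≤ P.Psi (-y) := by
  simp only [le_hcP_iff hP, le_Psi_iff hP, inner_toLp_eq, one_mul, PiLp.neg_apply, neg_mul,
    Finset.sum_neg_distrib]
  have hinner (u : Vec m) : inner ℝ y u = ∑ k, y k * u k := by
    simp [PiLp.inner_apply, mul_comm]
  refine ⟨fun h => ⟨fun k => ?_, fun x hx => ?_⟩, fun ⟨hy, h⟩ u x hx hxu => ?_⟩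
  · choose x hx using hP.nonempty
    refine neg_nonneg.1 <| nonneg_of_forall_le_add_mul
      (v := inner ℝ y (P.outcome x).snd - r) (c₀ := (P.outcome x).fst) fun s hs => ?_
    have := h ((P.outcome x).snd + EuclideanSpace.single k s) x hx fun l => by
      rw [PiLp.add_apply, PiLp.single_apply]
      split_ifs <;> simp [hs]
    rw [inner_add_right, EuclideanSpace.inner_single_right, conj_trivial] at this
    linarith
  · have := h (P.outcome x).snd x hx fun _ => le_rfl
    rw [hinner] at this
    linarith
  · have hyu : ∑ k, y k * u k ≤ ∑ k, y k * (P.outcome x).snd k :=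
      Finset.sum_le_sum fun k _ => mul_le_mul_of_nonpos_left (hxu k) (hy k)
    have := h x hx
    rw [hinner]
    linarith

theorem hcD_zero (hP : P.IsRegular) : P.hcD 0 = P.dualValue := by
  refine eq_of_forall_ge_iff fun c => biconj_le_iff.trans <| Iff.trans ?_ iSup₂_le_iff.symm
  simp only [affine_le_hcP_iff hP, inner_zero_right, zero_sub]
  refine ⟨fun h lam hlam => EReal.ge_of_forall_gt_iff_ge.1 fun q hq => ?_, fun h y r hyr => ?_⟩
  · simpa using h (-lam) (-q) ⟨fun k => by simpa using hlam k, by simpa using hq.le⟩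
  · exact hyr.2.trans (h (-y) fun k => by simpa using hyr.1 k)

theorem dualValue_ne_bot (hP : P.IsRegular) : P.dualValue ≠ ⊥ := by
  obtain ⟨B, hB⟩ := exists_le_outcome_fst hP
  have hPsi : (B : EReal) ≤ P.Psi 0 :=
    (le_Psi_iff hP).2 fun x hx => by simpa [inner_toLp_eq] using hB x hx
  exact ne_bot_of_le_ne_bot (EReal.coe_ne_bot B) (hPsi.trans (le_iSup₂_of_le 0 (by simp) le_rfl))

theorem dualValue_le_fst (hP : P.IsRegular) {z : ValSpace m} (hz : z ∈ P.epiHull)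
    (hnonpos : ∀ k, z.snd k ≤ 0) : P.dualValue ≤ z.fst := by
  refine iSup₂_le fun lam hlam => ((mem_epiHull_iff hP).1 hz lam hlam).trans ?_
  exact EReal.coe_le_coe_iff.2 <| add_le_of_nonpos_right <| Finset.sum_nonpos fun k _ =>
    mul_nonpos_of_nonneg_of_nonpos (hlam k) (hnonpos k)

theorem toLp_zero_mem_epiHull (hP : P.IsRegular) {r : ℝ} (hr : P.dualValue ≤ r) :
    WithLp.toLp 2 (r, 0) ∈ P.epiHull :=
  (mem_epiHull_iff hP).2 fun lam hlam => by
    simpa using (le_iSup₂_of_le lam hlam le_rfl).trans hr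

theorem attainsDual_of_fst_le (hP : P.IsRegular) {z : ValSpace m} (hz : z ∈ P.epiHull)
    (hnonpos : ∀ k, z.snd k ≤ 0) (hle : (z.fst : EReal) ≤ P.dualValue) : P.AttainsDual z where
  mem_hull := hz
  nonpos := hnonpos
  value := hle.antisymm (dualValue_le_fst hP hz hnonpos)
  lagrangian lam hlam hopt := by
    have hval : (z.fst : EReal) = P.Psi lam :=
      (hle.antisymm (dualValue_le_fst hP hz hnonpos)).trans hopt.symm
    have hmin : ∀ z' ∈ P.epiHull, z.fst ≤ z'.fst + ∑ k, lam k * z'.snd k := fun z' hz' =>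
      EReal.coe_le_coe_iff.1 (hval ▸ (mem_epiHull_iff hP).1 hz' lam hlam)
    have hslack : ∑ k, lam k * z.snd k = 0 :=
      (Finset.sum_nonpos fun k _ => mul_nonpos_of_nonneg_of_nonpos (hlam k) (hnonpos k)).antisymm
        (by linarith [hmin z hz])
    simp only [IsMinOn, IsMinFilter, Filter.eventually_principal, hslack, add_zero]
    exact ⟨hmin, hval⟩

end SepProblem

namespace SepProblem

open Finset

variable {n m : ℕ} {d : Fin n → ℕ} {P : SepProblem n m d} {x : ∀ i, Fin (m + 2) → Vec (d i)}
  {lam : Fin n → Fin (m + 2) → ℝ}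

theorem isRep_iff : P.IsRep x lam ↔
    (∀ i j, x i j ∈ P.Y i) ∧ ∀ i, lam i ∈ stdSimplex ℝ (Fin (m + 2)) := by
  simp only [IsRep, stdSimplex, Set.mem_ofPred_eq, forall_and]

theorem totalCard_eq (lam : Fin n → Fin (m + 2) → ℝ) :
    totalCard lam = ∑ i, #{j | lam i j ≠ 0} := by
  simp only [totalCard, ncard_setOf_ne_zero]

theorem isCompact_setOf_isRep (hP : P.IsRegular) :
    IsCompact {p : (∀ i, Fin (m + 2) → Vec (d i)) × (Fin n → Fin (m + 2) → ℝ) |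
      P.IsRep p.1 p.2} := by
  convert (isCompact_univ_pi fun i => isCompact_univ_pi fun _ : Fin (m + 2) =>
    hP.isCompact i).prod (isCompact_univ_pi fun _ : Fin n => isCompact_stdSimplex ℝ (Fin (m + 2)))
  ext p
  simp [isRep_iff]

theorem valCoord_repPoint (o : Option (Fin m)) (w : Vec m) : valCoord o (P.repPoint x lam w) =
    ∑ i, ∑ j, lam i j * valCoord o (P.val i (x i j)) +
      valCoord o (WithLp.toLp 2 (0, -P.b + w)) := by
  simp only [repPoint, map_add, map_sum, map_smul, smul_eq_mul]

theorem exists_isRep {T : Type*} [Fintype T] {y : ∀ i, T → Vec (d i)} (hy : ∀ i t, y i t ∈ P.Y i)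
    {μ : Fin n → T → ℝ} (hμ : ∀ i, μ i ∈ stdSimplex ℝ T) :
    ∃ (x : ∀ i, Fin (m + 2) → Vec (d i)) (lam : Fin n → Fin (m + 2) → ℝ),
      P.IsRep x lam ∧ totalCard lam ≤ n + m + 1 ∧
      ∑ i, ∑ j, lam i j • P.val i (x i j) = ∑ i, ∑ t, μ i t • P.val i (y i t) := by
  classical
  obtain ⟨α, hα, hsum, hcard⟩ := shapley_folkman (fun i t => P.val i (y i t)) hμ
  rw [finrank_valSpace, Fintype.card_fin] at hcard
  have hrow (i) : #{t | α i t ≠ 0} ≤ m + 2 := by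
    have hothers : n - 1 ≤ ∑ i' ∈ univ.erase i, #{t | α i' t ≠ 0} := by
      calc n - 1 = ∑ i' ∈ univ.erase i, 1 := by simp
        _ ≤ _ := sum_le_sum fun i' _ => (nonempty_of_mem_stdSimplex (hα i')).card_pos
    rw [← add_sum_erase _ _ (mem_univ i)] at hcard
    have := i.pos
    omega
  choose τ ν hν hνcard hfiber using fun i => exists_fin_reindex (hα i) (hrow i)
  refine ⟨fun i j => y i (τ i j), ν, isRep_iff.2 ⟨fun i j => hy i _, hν⟩, ?_, ?_⟩
  · simp only [totalCard_eq, hνcard]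
    omega
  · rw [← hsum]
    exact sum_congr rfl fun i _ => sum_smul_comp_eq (hfiber i) fun t => P.val i (y i t)

theorem repPoint_mem_epiHull (hP : P.IsRegular) (h : P.IsRep x lam) :
    P.repPoint x lam 0 ∈ P.epiHull := by
  obtain ⟨hx, hlam⟩ := isRep_iff.1 h
  have hconvex : Convex ℝ {p : Fin n → ValSpace m |
      ∑ i, p i + WithLp.toLp 2 (0, -P.b) ∈ P.epiHull} := by
    have hset : {p : Fin n → ValSpace m | ∑ i, p i + WithLp.toLp 2 (0, -P.b) ∈ P.epiHull} =
        (∑ i, LinearMap.proj i : (Fin n → ValSpace m) →ₗ[ℝ] ValSpace m) ⁻¹'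
          ((fun z => z + WithLp.toLp 2 (0, -P.b)) ⁻¹' P.epiHull) := by
      ext p
      simp
    rw [hset]
    exact ((convex_convexHull ℝ P.epiSet).closure.translate_preimage_left _).linear_preimage _
  have := pi_sum_smul_mem hconvex (z := fun i j => P.val i (x i j))
    (fun κ => outcome_mem_epiHull hP fun i => hx i (κ i)) hlam
  simpa [repPoint] using this

theorem isClosed_setOf_repPoint_le (hP : P.IsRegular) :
    IsClosed {z : ValSpace m | ∃ p ∈ {p : (∀ i, Fin (m + 2) → Vec (d i)) × _ | P.IsRep p.1 p.2},
      ∀ o, valCoord o (P.repPoint p.1 p.2 0) ≤ valCoord o z} := by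
  refine isClosed_setOf_exists_mem_forall_le (isCompact_setOf_isRep hP) (fun o => ?_)
    fun o => (valCoord o).continuous
  simp only [valCoord_repPoint]
  refine LowerSemicontinuousOn.add ?_ lowerSemicontinuousOn_const
  exact (lowerSemicontinuousOn_sum_mul hP.isCompact
    (lowerSemicontinuousOn_valCoord_val hP o)).mono fun p hp => ⟨hp.1, hp.2.1⟩

theorem exists_repPoint_le (hP : P.IsRegular) {z : ValSpace m} (hz : z ∈ P.epiHull) :
    ∃ p ∈ {p : (∀ i, Fin (m + 2) → Vec (d i)) × (Fin n → Fin (m + 2) → ℝ) | P.IsRep p.1 p.2},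
      ∀ o, valCoord o (P.repPoint p.1 p.2 0) ≤ valCoord o z := by
  refine closure_minimal (fun z hz => ?_) (isClosed_setOf_repPoint_le hP) hz
  obtain ⟨T, _, w, p, hw₀, hw₁, hp, rfl⟩ := mem_convexHull_iff_exists_fintype.1 hz
  choose y hy hle using fun t => (mem_epiSet_iff hP).1 (hp t)
  obtain ⟨x, lam, hrep, -, hsum⟩ := exists_isRep (P := P) (y := fun i t => y t i)
    (fun i t => hy t i) (μ := fun _ => w) fun _ => ⟨hw₀, hw₁⟩
  have heq : P.repPoint x lam 0 = ∑ t, w t • P.outcome (y t) := by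
    simp only [repPoint, hsum, outcome, smul_add, smul_sum, sum_add_distrib, ← sum_smul, hw₁,
      one_smul, add_zero, sum_comm (γ := T)]
  refine ⟨(x, lam), hrep, fun o => ?_⟩
  simp only [heq, map_sum, map_smul, smul_eq_mul]
  exact sum_le_sum fun t _ => mul_le_mul_of_nonneg_left (hle t o) (hw₀ t)

theorem exists_attainsDual (hP : P.IsRegular) (htop : P.dualValue ≠ ⊤) :
    ∃ (x : ∀ i, Fin (m + 2) → Vec (d i)) (lam : Fin n → Fin (m + 2) → ℝ) (w : Vec m),
      P.IsRep x lam ∧ totalCard lam ≤ n + m + 1 ∧ (∀ k, 0 ≤ w k) ∧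
      P.AttainsDual (P.repPoint x lam w) := by
  have hr := EReal.coe_toReal htop (dualValue_ne_bot hP)
  obtain ⟨⟨y, μ⟩, hμ, hle⟩ := exists_repPoint_le hP (toLp_zero_mem_epiHull hP hr.ge)
  obtain ⟨hy, hμ'⟩ := isRep_iff.1 hμ
  obtain ⟨x, lam, hrep, hcard, hsum⟩ := exists_isRep hy hμ'
  have heq : P.repPoint x lam 0 = P.repPoint y μ 0 := by rw [repPoint, repPoint, hsum]
  refine ⟨x, lam, 0, hrep, hcard, fun _ => le_rfl, heq ▸ ?_⟩
  exact attainsDual_of_fst_le hP (repPoint_mem_epiHull hP hμ) (fun k => hle (some k))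
    (hr ▸ EReal.coe_le_coe_iff.2 (hle none))

end SepProblem

namespace SepProblem

open Finset

variable {n m : ℕ} {d : Fin n → ℕ} {P : SepProblem n m d} {i : Fin n}

theorem fY_eq_coe (hP : P.IsRegular) {x : Vec (d i)} (hx : x ∈ P.Y i) :
    P.fY i x = ((P.f i x).toReal : ℝ) := by
  rw [fY, extendTop, if_pos hx, hP.coe_f i x hx]

theorem mem_Y_of_fY_lt_top {x : Vec (d i)} (h : P.fY i x < ⊤) : x ∈ P.Y i := by
  by_contra hx
  simp [fY, extendTop, hx] at h

theorem gY_eq_coe {x : Vec (d i)} (hx : x ∈ P.Y i) (k : Fin m) : P.gY i k x = (P.g i x k : ℝ) :=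
  if_pos hx

theorem g_sum_smul_le (hρ : P.rhoBarG ≠ ⊤) {T : Type*} [Fintype T] {y : T → Vec (d i)}
    (hy : ∀ t, y t ∈ P.Y i) {μ : T → ℝ} (hμ : μ ∈ stdSimplex ℝ T)
    (hx : ∑ t, μ t • y t ∈ P.Y i) (k : Fin m) :
    P.g i (∑ t, μ t • y t) k ≤ ∑ t, μ t * P.g i (y t) k + P.rhoBarG.toReal := by
  have hgap : ((P.g i (∑ t, μ t • y t) k : ℝ) : EReal) ≤
      ((∑ t, μ t * P.g i (y t) k : ℝ) : EReal) + P.rhoBarG := by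
    have hdom : ∑ t, μ t • y t ∈ effDom (P.gY i k) :=
      (gY_eq_coe hx k).trans_lt (EReal.coe_lt_top _)
    rw [← gY_eq_coe hx k]
    refine (le_sum_add_rho (fun t => (gY_eq_coe (hy t) k).le) hμ hdom).trans ?_
    exact add_le_add_right (le_iSup₂ (f := fun i k => rho (P.gY i k)) i k) _
  have hbot : P.rhoBarG ≠ ⊥ := fun h => by simp [h] at hgap
  rw [← EReal.coe_toReal hρ hbot] at hgap
  exact_mod_cast hgap

theorem rhoBarG_toReal_nonneg (hP : P.IsRegular) (hρ : P.rhoBarG ≠ ⊤) :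
    0 ≤ P.rhoBarG.toReal := by
  by_cases h : Nonempty (Fin n × Fin m)
  · obtain ⟨i, k⟩ := h
    obtain ⟨x, hx⟩ := hP.nonempty i
    simpa using g_sum_smul_le hρ (fun _ : Unit => hx) (μ := fun _ => 1) (by simp [stdSimplex])
      (by simpa using hx) k
  · have hbot : P.rhoBarG = ⊥ := by
      simp only [rhoBarG, iSup_eq_bot]
      exact fun i k => absurd ⟨(i, k)⟩ h
    simp [hbot]

variable {y : ∀ i, Fin (m + 2) → Vec (d i)} {μ : Fin n → Fin (m + 2) → ℝ}

theorem sum_g_sum_smul_le (hρ : P.rhoBarG ≠ ⊤) (hrep : P.IsRep y μ)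
    (hx : ∀ i, ∑ j, μ i j • y i j ∈ P.Y i) (k : Fin m) :
    ∑ i, P.g i (∑ j, μ i j • y i j) k ≤
      ∑ i, ∑ j, μ i j * P.g i (y i j) k + #{i | 1 < #{j | μ i j ≠ 0}} * P.rhoBarG.toReal := by
  obtain ⟨hy, hμ⟩ := isRep_iff.1 hrep
  have hrow (i) : P.g i (∑ j, μ i j • y i j) k ≤ ∑ j, μ i j * P.g i (y i j) k +
      if 1 < #{j | μ i j ≠ 0} then P.rhoBarG.toReal else 0 := by
    split_ifs with hcard
    · exact g_sum_smul_le hρ (hy i) (hμ i) (hx i) k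
    · obtain ⟨t, ht⟩ := eq_single_of_card_ne_zero_le_one (hμ i) (not_lt.1 hcard)
      simp [ht, Pi.single_apply]
  refine (sum_le_sum fun i _ => hrow i).trans_eq ?_
  rw [sum_add_distrib, ← sum_filter, sum_const, nsmul_eq_mul]

theorem sum_rhoK_le_maxRho (hμ : ∀ i, μ i ∈ stdSimplex ℝ (Fin (m + 2))) {s : ℝ}
    (hs : (totalCard μ : ℝ) ≤ s) : ∑ i, rhoK #{j | μ i j ≠ 0} (P.fY i) ≤ P.maxRho s := by
  refine le_iSup₂_of_le (fun i => #{j | μ i j ≠ 0}) ⟨fun i => ⟨?_, ?_⟩, ?_⟩ le_rfl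
  · exact (nonempty_of_mem_stdSimplex (hμ i)).card_pos
  · exact (card_le_univ _).trans_eq (Fintype.card_fin _)
  · rwa [← totalCard_eq]

theorem sum_f_sum_smul_le (hP : P.IsRegular) (hrep : P.IsRep y μ) {s : ℝ}
    (hs : (totalCard μ : ℝ) ≤ s) (hmax : P.maxRho s ≠ ⊤) :
    (∀ i, ∑ j, μ i j • y i j ∈ P.Y i) ∧ ∑ i, P.f i (∑ j, μ i j • y i j) ≤
      ((∑ i, ∑ j, μ i j * (P.f i (y i j)).toReal : ℝ) : EReal) + P.maxRho s := by
  obtain ⟨hy, hμ⟩ := isRep_iff.1 hrep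
  have hsum := sum_rhoK_le_maxRho (P := P) hμ hs
  have hrow (i) : P.fY i (∑ j, μ i j • y i j) ≤
      ((∑ j, μ i j * (P.f i (y i j)).toReal : ℝ) : EReal) + rhoK #{j | μ i j ≠ 0} (P.fY i) :=
    le_sum_add_rhoK (fun j => fY_eq_coe hP (hy i j)) (hμ i) le_rfl
  have hnonneg (i) : 0 ≤ rhoK #{j | μ i j ≠ 0} (P.fY i) := by
    obtain ⟨x, hx⟩ := hP.nonempty i
    exact rhoK_nonneg (fY_eq_coe hP hx) (nonempty_of_mem_stdSimplex (hμ i)).card_pos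
  have hmem (i) : ∑ j, μ i j • y i j ∈ P.Y i := by
    have hfin : rhoK #{j | μ i j ≠ 0} (P.fY i) < ⊤ :=
      ((single_le_sum (fun i _ => hnonneg i) (mem_univ i)).trans hsum).trans_lt hmax.lt_top
    exact mem_Y_of_fY_lt_top <| (hrow i).trans_lt <| EReal.add_lt_top (EReal.coe_ne_top _) hfin.ne
  refine ⟨hmem, ?_⟩
  calc ∑ i, P.f i (∑ j, μ i j • y i j) = ∑ i, P.fY i (∑ j, μ i j • y i j) :=
        sum_congr rfl fun i _ => (if_pos (hmem i)).symm
    _ ≤ ∑ i, (((∑ j, μ i j * (P.f i (y i j)).toReal : ℝ) : EReal) +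
          rhoK #{j | μ i j ≠ 0} (P.fY i)) := sum_le_sum fun i _ => hrow i
    _ ≤ _ := by
        rw [sum_add_distrib, ← ereal_coe_sum]
        exact add_le_add_right hsum _

theorem hcP_shift_le (hP : P.IsRegular) (hρ : P.rhoBarG ≠ ⊤) (hrep : P.IsRep y μ) {w : Vec m}
    (hw : ∀ k, 0 ≤ w k) (hrows : #{i | 1 < #{j | μ i j ≠ 0}} ≤ m + 1) {s : ℝ}
    (hs : (totalCard μ : ℝ) ≤ s) {z : ValSpace m} (hz : ∀ k, z.snd k ≤ 0) :
    P.hcP (P.shift (P.repPoint y μ w - z).snd) ≤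
      (z.fst : EReal) + (((|(P.repPoint y μ w - z).fst| : ℝ) : EReal) + P.maxRho s) := by
  rcases eq_or_ne (P.maxRho s) ⊤ with hmax | hmax
  · simp [hmax]
  obtain ⟨hmem, hf⟩ := sum_f_sum_smul_le hP hrep hs hmax
  have hfst : (P.repPoint y μ w).fst = ∑ i, ∑ j, μ i j * (P.f i (y i j)).toReal := by
    simpa [valCoord_none, val] using valCoord_repPoint (P := P) (x := y) (lam := μ) none w
  have hsnd (k : Fin m) : (P.repPoint y μ w).snd k =
      ∑ i, ∑ j, μ i j * P.g i (y i j) k + (-P.b k + w k) := by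
    simpa [valCoord_some, val] using valCoord_repPoint (P := P) (x := y) (lam := μ) (some k) w
  have hfeasible (k : Fin m) : ∑ i, P.g i (∑ j, μ i j • y i j) k - P.b k ≤
      P.shift (P.repPoint y μ w - z).snd k := by
    have hg := sum_g_sum_smul_le hρ hrep hmem k
    have hrows' : #{i | 1 < #{j | μ i j ≠ 0}} * P.rhoBarG.toReal ≤
        (m + 1) * P.rhoBarG.toReal :=
      mul_le_mul_of_nonneg_right (by exact_mod_cast hrows) (rhoBarG_toReal_nonneg hP hρ)
    simp only [shift, WithLp.sub_snd, PiLp.sub_apply, hsnd]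
    linarith [hw k, hz k]
  calc P.hcP (P.shift (P.repPoint y μ w - z).snd)
      ≤ ∑ i, P.f i (∑ j, μ i j • y i j) := iInf₂_le _ ⟨hmem, hfeasible⟩
    _ ≤ ((P.repPoint y μ w).fst : EReal) + P.maxRho s := hfst ▸ hf
    _ ≤ ((z.fst + |(P.repPoint y μ w - z).fst| : ℝ) : EReal) + P.maxRho s := by
        refine add_le_add_left (EReal.coe_le_coe_iff.2 ?_) _
        rw [WithLp.sub_fst]
        linarith [le_abs_self ((P.repPoint y μ w).fst - z.fst)]
    _ = _ := by rw [EReal.coe_add, add_assoc]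

end SepProblem

namespace SepProblem

open Finset

variable {n m : ℕ} {d : Fin n → ℕ} {P : SepProblem n m d} {x : ∀ i, Fin (m + 2) → Vec (d i)}
  {lam : Fin n → Fin (m + 2) → ℝ} {γ : ℝ}

theorem norm_sum_smul_val_le (hM : P.MV ≠ ⊤) {x : ∀ i, Vec (d i)} (hx : ∀ i, x i ∈ P.Y i)
    (δ : Vec n) : ‖∑ i, δ i • P.val i (x i)‖ ≤ P.MV.toReal * ‖δ‖ := by
  rcases eq_or_ne δ 0 with rfl | hδ
  · simp
  have hδ₀ : 0 < ‖δ‖ := norm_pos_iff.2 hδ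
  have hunit : ‖∑ i, (‖δ‖⁻¹ • δ) i • P.val i (x i)‖ₑ ≤ P.MV :=
    le_iSup_of_le (‖δ‖⁻¹ • δ) <| le_iSup₂_of_le x
      ⟨by rw [norm_smul, norm_inv, norm_norm, inv_mul_cancel₀ hδ₀.ne'], hx⟩ le_rfl
  simp only [PiLp.smul_apply, smul_eq_mul, mul_smul, ← smul_sum] at hunit
  have hreal := ENNReal.toReal_mono hM hunit
  rwa [toReal_enorm, norm_smul, norm_inv, norm_norm, inv_mul_le_iff₀ hδ₀, mul_comm] at hreal

theorem enorm_le_weightRadius {i : Fin n} {j : Fin (m + 2)} (h : lam i j ≠ 1) :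
    ‖lam i j‖ₑ ≤ weightRadius lam :=
  le_iSup_of_le i (le_iSup₂_of_le j h le_rfl)

theorem enorm_le_Rv {i : Fin n} {j : Fin (m + 2)} (h : lam i j ≠ 1) :
    ‖lam i j • P.val i (x i j)‖ₑ ≤ P.Rv x lam :=
  le_iSup_of_le i (le_iSup₂_of_le j h le_rfl)

theorem weightRadius_ne_top : weightRadius lam ≠ ⊤ :=
  iSup_ne_top fun _ => iSup_ne_top fun _ => iSup_ne_top fun _ => enorm_ne_top

theorem Rv_ne_top : P.Rv x lam ≠ ⊤ :=
  iSup_ne_top fun _ => iSup_ne_top fun _ => iSup_ne_top fun _ => enorm_ne_top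

theorem totalCard_le_add_card_fractional (hlam : ∀ i, lam i ∈ stdSimplex ℝ (Fin (m + 2))) :
    totalCard lam ≤ n + ∑ i, #(fractional (lam i)) := by
  calc totalCard lam ≤ ∑ i, (1 + #(fractional (lam i))) :=
        totalCard_eq lam ▸ sum_le_sum fun i _ => card_ne_zero_le_one_add_card_fractional (hlam i)
    _ = n + ∑ i, #(fractional (lam i)) := by simp [sum_add_distrib]

theorem sum_card_fractional_add_le (hlam : ∀ i, lam i ∈ stdSimplex ℝ (Fin (m + 2))) :
    ∑ i, #(fractional (lam i)) + 2 * n ≤ 2 * totalCard lam := by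
  calc ∑ i, #(fractional (lam i)) + 2 * n = ∑ i, (#(fractional (lam i)) + 2) := by
        simp [sum_add_distrib, mul_comm]
    _ ≤ ∑ i, 2 * #{j | lam i j ≠ 0} := sum_le_sum fun i _ => card_fractional_add_two_le (hlam i)
    _ = 2 * totalCard lam := by rw [totalCard_eq, mul_sum]

theorem totalCard_le_sparsity {c : ℝ} (hc : 0 ≤ c)
    (hcard : totalCard lam ≤ n + (⌊2 * m * (c / (γ ^ 2 + c))⌋₊ + 1)) :
    (totalCard lam : ℝ) ≤ sparsity n m c γ := by
  have hfloor := Nat.floor_le (a := 2 * (m : ℝ) * (c / (γ ^ 2 + c))) (by positivity)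
  have : (totalCard lam : ℝ) ≤ n + (⌊2 * m * (c / (γ ^ 2 + c))⌋₊ + 1) := by exact_mod_cast hcard
  rw [sparsity]
  linarith

/- Below the trivial level `m` one has `γ² ≥ 16`, hence `16 m ≤ γ² t`, while `N ≤ 4 m`: the
constant `16` is the square of this `4`. -/
theorem sampling_bound {N : ℕ} {Q : ℝ} (hQ : 0 ≤ Q) (hN : N ≤ 2 * m + 2)
    (hlt : 2 * m * (16 / (γ ^ 2 + 16)) < (m : ℝ)) :
    2 * (N : ℝ) ^ 2 * Q / ((⌊2 * m * (16 / (γ ^ 2 + 16))⌋₊ + 1 : ℕ) : ℝ) ≤ 2 * m * γ ^ 2 * Q := by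
  set t := 2 * (m : ℝ) * (16 / (γ ^ 2 + 16)) with ht
  have hm : (1 : ℝ) ≤ m := by
    rcases m.eq_zero_or_pos with rfl | h
    · simp [ht] at hlt
    · exact_mod_cast h
  have htγ : t * (γ ^ 2 + 16) = 32 * m := by
    rw [ht]
    field_simp
    ring
  have hγ : 16 ≤ γ ^ 2 := by nlinarith
  have hN' : (N : ℝ) ≤ 4 * m := by
    have : (N : ℝ) ≤ 2 * m + 2 := by exact_mod_cast hN
    linarith
  have hlevel : 16 * m ≤ γ ^ 2 * t := by nlinarith
  rw [div_le_iff₀ (by positivity)]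
  calc 2 * (N : ℝ) ^ 2 * Q ≤ 2 * (4 * m) ^ 2 * Q := by gcongr
    _ = 2 * m * (16 * m) * Q := by ring
    _ ≤ 2 * m * (γ ^ 2 * t) * Q := by gcongr
    _ ≤ 2 * m * (γ ^ 2 * ((⌊t⌋₊ + 1 : ℕ) : ℝ)) * Q := by
      gcongr
      exact_mod_cast (Nat.lt_floor_add_one t).le
    _ = _ := by ring

theorem repPoint_sub_repPoint (x : ∀ i, Fin (m + 2) → Vec (d i))
    (μ lam : Fin n → Fin (m + 2) → ℝ) (w : Vec m) :
    P.repPoint x μ w - P.repPoint x lam w =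
      ∑ i, ∑ j, μ i j • P.val i (x i j) - ∑ i, ∑ j, lam i j • P.val i (x i j) :=
  add_sub_add_right_eq_sub _ _ _

theorem exists_sparse_weights_of_MV_ne_top (hx : ∀ i j, x i j ∈ P.Y i)
    (hlam : ∀ i, lam i ∈ stdSimplex ℝ (Fin (m + 2))) (hcard : totalCard lam ≤ n + m + 1)
    (hγ : 0 < γ) (hsparse : sparsity n m 16 γ < totalCard lam) (hM : P.MV ≠ ⊤) (w : Vec m) :
    ∃ μ : Fin n → Fin (m + 2) → ℝ, (∀ i, μ i ∈ stdSimplex ℝ (Fin (m + 2))) ∧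
      (totalCard μ : ℝ) ≤ sparsity n m 16 γ ∧ (∀ i j, lam i j = 0 → μ i j = 0) ∧
      ‖P.repPoint x μ w - P.repPoint x lam w‖ ≤ Real.sqrt (2 * m) *
        ((P.Rv x lam).toReal + (weightRadius lam).toReal * P.MV.toReal) * γ := by
  set R := (P.Rv x lam).toReal
  set Λ := (weightRadius lam).toReal
  set M := P.MV.toReal
  have hcard' : (totalCard lam : ℝ) ≤ n + m + 1 := by exact_mod_cast hcard
  have hlevel : 0 ≤ 2 * (m : ℝ) * (16 / (γ ^ 2 + 16)) := by positivity
  rw [sparsity] at hsparse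
  have hlt : 2 * m * (16 / (γ ^ 2 + 16)) < (m : ℝ) := by linarith
  have hgt : n < totalCard lam := by
    exact_mod_cast (by linarith : (n : ℝ) < totalCard lam)
  have hfrac := totalCard_le_add_card_fractional hlam
  have hfrac' := sum_card_fractional_add_le hlam
  have hR : ∀ i, ∀ j ∈ fractional (lam i), ‖lam i j • P.val i (x i j)‖ ≤ R := fun i j hj => by
    simpa using ENNReal.toReal_mono Rv_ne_top (enorm_le_Rv (P := P) (mem_fractional.1 hj).2)
  have hΛ : ∀ i, ∀ j ∈ fractional (lam i), lam i j ≤ Λ := fun i j hj =>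
    (Real.le_norm_self _).trans <| by
      simpa using ENNReal.toReal_mono weightRadius_ne_top
        (enorm_le_weightRadius (mem_fractional.1 hj).2)
  obtain ⟨μ, hμ, hμ₀, hμcard, hbound⟩ := exists_sparse_weights
    (fun i j => P.val i (x i j)) hlam (M := M)
    (fun δ κ => norm_sum_smul_val_le hM (fun i => hx i (κ i)) δ) hR hΛ (by omega)
    (Nat.succ_pos ⌊2 * (m : ℝ) * (16 / (γ ^ 2 + 16))⌋₊)
  rw [Fintype.card_fin, ← totalCard_eq] at hμcard
  refine ⟨μ, hμ, totalCard_le_sparsity (by norm_num) hμcard, hμ₀, ?_⟩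
  have hR₀ : 0 ≤ R := ENNReal.toReal_nonneg
  have hΛM : 0 ≤ Λ * M := mul_nonneg ENNReal.toReal_nonneg ENNReal.toReal_nonneg
  refine (sq_le_sq₀ (norm_nonneg _) (by positivity)).1 ?_
  calc _ ≤ 2 * m * γ ^ 2 * (R ^ 2 + M ^ 2 * Λ ^ 2) :=
        repPoint_sub_repPoint x μ lam w ▸
          hbound.trans (sampling_bound (by positivity) (by omega) hlt)
    _ ≤ 2 * m * γ ^ 2 * (R + Λ * M) ^ 2 := by
        gcongr
        nlinarith [mul_nonneg hR₀ hΛM]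
    _ = _ := by
        rw [mul_pow, mul_pow, Real.sq_sqrt (by positivity)]
        ring

theorem sampling_error_eq_top (hM : P.MV = ⊤) (hm : m ≠ 0) (hγ : 0 < γ)
    (hlam : ∀ i, lam i ∈ stdSimplex ℝ (Fin (m + 2))) (hcard : n < totalCard lam) :
    ENNReal.ofReal (Real.sqrt (2 * m)) * (P.Rv x lam + weightRadius lam * P.MV) *
      ENNReal.ofReal γ = ⊤ := by
  have hpos : ∑ i, #(fractional (lam i)) ≠ 0 := by
    have := totalCard_le_add_card_fractional hlam
    omega
  obtain ⟨i, -, hi⟩ := exists_ne_zero_of_sum_ne_zero hpos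
  obtain ⟨j, hj⟩ := card_ne_zero.1 hi
  rw [mem_fractional] at hj
  have hΛ : weightRadius lam ≠ 0 :=
    ((enorm_pos.2 hj.1).trans_le (enorm_le_weightRadius hj.2)).ne'
  have hsqrt : ENNReal.ofReal (Real.sqrt (2 * m)) ≠ 0 := by
    rw [Ne, ENNReal.ofReal_eq_zero, not_le, Real.sqrt_pos]
    positivity
  have hγ' : ENNReal.ofReal γ ≠ 0 := by rwa [Ne, ENNReal.ofReal_eq_zero, not_le]
  rw [hM, ENNReal.mul_top hΛ, add_top, ENNReal.mul_top hsqrt, ENNReal.top_mul hγ']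

theorem exists_sparse_rep (w : Vec m) (hrep : P.IsRep x lam) (hcard : totalCard lam ≤ n + m + 1)
    (hγ : 0 < γ) :
    ∃ μ : Fin n → Fin (m + 2) → ℝ, P.IsRep x μ ∧ (totalCard μ : ℝ) ≤ sparsity n m 16 γ ∧
      (∀ i j, lam i j = 0 → μ i j = 0) ∧
      ‖P.repPoint x μ w - P.repPoint x lam w‖ₑ ≤ ENNReal.ofReal (Real.sqrt (2 * m)) *
        (P.Rv x lam + weightRadius lam * P.MV) * ENNReal.ofReal γ := by
  rcases le_or_gt (totalCard lam : ℝ) (sparsity n m 16 γ) with hs | hs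
  · exact ⟨lam, hrep, hs, fun _ _ => id, by simp⟩
  obtain ⟨hx, hlam⟩ := isRep_iff.1 hrep
  by_cases hM : P.MV = ⊤
  · choose j hj using fun i => nonempty_of_mem_stdSimplex (hlam i)
    have hsingle : totalCard (fun i => Pi.single (j i) 1 : Fin n → Fin (m + 2) → ℝ) = n := by
      simp [totalCard, Pi.single_apply]
    have hlevel : (n : ℝ) + 1 ≤ sparsity n m 16 γ :=
      le_add_of_nonneg_right (by positivity)
    have hgt : n + 1 < totalCard lam := by exact_mod_cast hlevel.trans_lt hs
    refine ⟨fun i => Pi.single (j i) 1, isRep_iff.2 ⟨hx, fun i => single_mem_stdSimplex ℝ (j i)⟩,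
      ?_, fun i t ht => Pi.single_eq_of_ne ?_ _, ?_⟩
    · rw [hsingle]
      linarith
    · rintro rfl
      exact (mem_filter_univ (j i)).1 (hj i) ht
    · rw [sampling_error_eq_top hM (by omega) hγ hlam (by omega)]
      exact le_top
  · obtain ⟨μ, hμ, hμcard, hμ₀, hbound⟩ :=
      exists_sparse_weights_of_MV_ne_top hx hlam hcard hγ hs hM w
    refine ⟨μ, isRep_iff.2 ⟨hx, hμ⟩, hμcard, hμ₀, ?_⟩
    calc ‖P.repPoint x μ w - P.repPoint x lam w‖ₑ ≤ ENNReal.ofReal _ :=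
          ofReal_norm (P.repPoint x μ w - P.repPoint x lam w) ▸ ENNReal.ofReal_le_ofReal hbound
      _ = _ := by
          rw [ENNReal.ofReal_mul (by positivity), ENNReal.ofReal_mul (by positivity),
            ENNReal.ofReal_add (by positivity) (by positivity),
            ENNReal.ofReal_mul (by positivity), ENNReal.ofReal_toReal Rv_ne_top,
            ENNReal.ofReal_toReal weightRadius_ne_top, ENNReal.ofReal_toReal hM]

theorem card_rows_le {μ : Fin n → Fin (m + 2) → ℝ}
    (hμ : ∀ i, μ i ∈ stdSimplex ℝ (Fin (m + 2))) (hsupp : ∀ i j, lam i j = 0 → μ i j = 0)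
    (hcard : totalCard lam ≤ n + m + 1) : #{i | 1 < #{j | μ i j ≠ 0}} ≤ m + 1 := by
  have hrow (i) : (1 + if 1 < #{j | μ i j ≠ 0} then 1 else 0) ≤ #{j | lam i j ≠ 0} := by
    have hle : #{j | μ i j ≠ 0} ≤ #{j | lam i j ≠ 0} :=
      card_le_card (monotone_filter_right _ fun j _ h h₀ => h (hsupp i j h₀))
    have := (nonempty_of_mem_stdSimplex (hμ i)).card_pos
    split_ifs <;> omega
  have htotal := sum_le_sum fun i (_ : i ∈ univ) => hrow i
  rw [sum_add_distrib, ← card_filter, ← totalCard_eq] at htotal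
  simp only [sum_const, card_univ, Fintype.card_fin, smul_eq_mul, mul_one] at htotal
  omega

end SepProblem

theorem mainTheorem9 :
    ∃ c : ℝ, 0 < c ∧
      ∀ (n m : ℕ) (d : Fin n → ℕ) (P : SepProblem n m d),
        (∀ i, LowerSemicontinuous (P.f i)) →
        (∀ i k, LowerSemicontinuous fun x => P.g i x k) →
        (∀ i, IsCompact (P.Y i)) →
        (∀ i, P.Y i ⊆ effDom (P.f i)) →
        (∀ i, IsTame fun x => P.fY i x + ((∑ k, P.g i x k : ℝ) : EReal)) →
        P.rhoBarG ≠ ⊤ →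
        P.hcD 0 ≠ ⊤ →
        P.hcD 0 = P.dualValue ∧
        (∃ (x : ∀ i, Fin (m + 2) → Vec (d i)) (lam : Fin n → Fin (m + 2) → ℝ) (w : Vec m),
          P.IsRep x lam ∧ totalCard lam ≤ n + m + 1 ∧ (∀ k, 0 ≤ w k) ∧
          P.AttainsDual (P.repPoint x lam w)) ∧
        ∀ (x : ∀ i, Fin (m + 2) → Vec (d i)) (lam : Fin n → Fin (m + 2) → ℝ) (w : Vec m),
          P.IsRep x lam → totalCard lam ≤ n + m + 1 → (∀ k, 0 ≤ w k) →
          P.AttainsDual (P.repPoint x lam w) →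
          ∀ γ : ℝ, 0 < γ →
            ∃ (u : ValSpace m) (y : ∀ i, Fin (m + 2) → Vec (d i)) (μ : Fin n → Fin (m + 2) → ℝ),
              P.IsRep y μ ∧ (totalCard μ : ℝ) ≤ sparsity n m c γ ∧
              u = P.repPoint y μ w - P.repPoint x lam w ∧
              P.hcD (P.shift u.snd) ≤ P.hcP (P.shift u.snd) ∧
              P.hcP (P.shift u.snd) ≤
                P.hcD 0 + (((|u.fst| : ℝ) : EReal) + P.maxRho (sparsity n m c γ)) ∧
              max ‖u.fst‖ₑ ‖u.snd‖ₑ ≤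
                ENNReal.ofReal (Real.sqrt (2 * m)) *
                  (P.Rv x lam + weightRadius lam * P.MV) * ENNReal.ofReal γ := by
  refine ⟨16, by norm_num, fun n m d P hf hg hY hdom htame hρ htop => ?_⟩
  have hP := SepProblem.isRegular_of_isTame hf hg hY hdom htame
  have hD := SepProblem.hcD_zero hP
  refine ⟨hD, SepProblem.exists_attainsDual hP (hD ▸ htop),
    fun x lam w hrep hcard hw hatt γ hγ => ?_⟩
  obtain ⟨μ, hμ, hμcard, hsupp, hbound⟩ := SepProblem.exists_sparse_rep w hrep hcard hγ
  have hrows := SepProblem.card_rows_le (SepProblem.isRep_iff.1 hμ).2 hsupp hcard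
  refine ⟨_, x, μ, hμ, hμcard, rfl, biconj_le _ _, ?_, ?_⟩
  · rw [hD, ← hatt.value]
    exact SepProblem.hcP_shift_le hP hρ hμ hw hrows hμcard hatt.nonpos
  · exact (max_le (WithLp.enorm_fst_le _ _) (WithLp.enorm_snd_le _ _)).trans hbound
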